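/- All digraphs are finite and simple (no loops and no parallel arcs; a pair of opposite arcs is allowed). For a digraph $D$, a \emph{directed odd cycle transversal} of $D$ is a set $S\subseteq V(D)$ such that $D-S$ contains no directed cycle of odd length; let $\mathrm{opt}(D)$ be the minimum size of such a set, and call a directed odd cycle transversal of size $\mathrm{opt}(D)$ \emph{optimal}. A vertex $v\in V(D)$ is \emph{$3$-essential} if $v\in S$ for every directed odd cycle transversal $S$ of $D$ with $|S|\le 3\cdot\mathrm{opt}(D)$. There is an algorithm that, given a digraph $D$ and an integer $k$, runs in time polynomial in the size of the input $(D,k)$ and outputs a vertex set $S\subseteq V(D)$ such that 1. if $\mathrm{opt}(D)\le k$, then there is an optimal directed odd cycle transversal of $D$ that contains all of $S$; and 2. if $\mathrm{opt}(D)=k$, then $S$ contains all $3$-essential vertices of $D$. That is, there is a polynomial-time algorithm for $3$-Essential Detection for Directed Odd Cycle Transversal. -/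

import Mathlib

/-! ### Random access machines with a step count -/

namespace RAM

/-- Instructions of a random access machine. The machine has registers `reg 0, reg 1, …`, addressed
directly by the (fixed) program, and a random access memory `mem 0, mem 1, …`, addressed through
registers; every cell holds a natural number. The only arithmetic is addition and (truncated)
subtraction, so that unit-cost time is polynomially related to Turing machine time. -/
inductive Instr : Type
  /-- `reg i := c` -/
  | const (i c : ℕ)
  /-- `reg i := reg j + reg l` -/
  | add (i j l : ℕ)
  /-- `reg i := max (reg j - reg l) 0` -/
  | sub (i j l : ℕ)
  /-- `reg i := mem (reg j)` -/
  | load (i j : ℕ)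
  /-- `mem (reg i) := reg j` -/
  | store (i j : ℕ)
  /-- if `reg j > 0`, continue with instruction number `target` -/
  | jumpPos (j target : ℕ)

/-- A program is a finite list of instructions. -/
abbrev Program : Type := List Instr

/-- A configuration: the program counter, the registers and the memory. -/
structure Config : Type where
  pc : ℕ
  reg : ℕ → ℕ
  mem : ℕ → ℕ

/-- The effect of one instruction. -/
def Instr.exec (C : Config) : Instr → Config
  | .const i c => ⟨C.pc + 1, Function.update C.reg i c, C.mem⟩
  | .add i j l => ⟨C.pc + 1, Function.update C.reg i (C.reg j + C.reg l), C.mem⟩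
  | .sub i j l => ⟨C.pc + 1, Function.update C.reg i (C.reg j - C.reg l), C.mem⟩
  | .load i j => ⟨C.pc + 1, Function.update C.reg i (C.mem (C.reg j)), C.mem⟩
  | .store i j => ⟨C.pc + 1, C.reg, Function.update C.mem (C.reg i) (C.reg j)⟩
  | .jumpPos j target => ⟨if 0 < C.reg j then target else C.pc + 1, C.reg, C.mem⟩

/-- The machine has halted when the program counter points outside the program. -/
def Halted (P : Program) (C : Config) : Prop := P.length ≤ C.pc

/-- One step of the machine; a halted configuration does not change. -/
def step (P : Program) (C : Config) : Config :=
  match P[C.pc]? with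
  | none => C
  | some instr => instr.exec C

/-- The initial configuration on the input `w`: the words of `w` stand at the start of the memory,
and everything else is `0`. -/
def initial (w : List ℕ) : Config := ⟨0, fun _ => 0, fun a => w.getD a 0⟩

/-- The size of an input: the total binary length of its words (plus one for each word). -/
def inputSize (w : List ℕ) : ℕ := (w.map fun x => Nat.size x + 1).sum

/-- The search problem whose instances `a : α` are given to the machine as the words `encode a`, and
whose correct answers (read off from the memory after halting) are described by `Correct a`, is
solvable in polynomial time: a single program halts with a correct answer on each instance, after a
number of steps that is bounded by a polynomial in the size of the input. -/
def SolvableInPolyTime {α : Type*} (encode : α → List ℕ) (Correct : α → (ℕ → ℕ) → Prop) : Prop :=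
  ∃ (P : Program) (p : Polynomial ℕ), ∀ a : α, ∃ t : ℕ, t ≤ p.eval (inputSize (encode a)) ∧
    Halted P ((step P)^[t] (initial (encode a))) ∧
      Correct a ((step P)^[t] (initial (encode a))).mem

end RAM

/-! ### Vertex-subset minimization problems and essential vertices

The feasible solutions of the problem on a given (di)graph with vertex set `V` are described by a
predicate `Sol` on vertex sets. -/

section Essential

/-- The minimum size of a feasible solution. -/
noncomputable def optSize {V : Type*} (Sol : Finset V → Prop) : ℕ :=
  sInf {m : ℕ | ∃ S : Finset V, Sol S ∧ S.card = m}

/-- An optimal solution is a feasible solution of minimum size. -/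
def IsOptimalSolution {V : Type*} (Sol : Finset V → Prop) (S : Finset V) : Prop :=
  Sol S ∧ S.card = optSize Sol

/-- A vertex is `c`-essential if it lies in each feasible solution of size at most `c * opt`. -/
def IsEssential {V : Type*} (c : ℝ) (Sol : Finset V → Prop) (v : V) : Prop :=
  ∀ S : Finset V, Sol S → (S.card : ℝ) ≤ c * (optSize Sol : ℝ) → v ∈ S

/-- `S` is a correct output of `c`-Essential Detection when the integer `k` is supplied. -/
structure IsEssentialDetectionOutput {V : Type*} (c : ℝ) (Sol : Finset V → Prop) (k : ℤ)
    (S : Finset V) : Prop where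
  subset_optimal : (optSize Sol : ℤ) ≤ k → ∃ T : Finset V, IsOptimalSolution Sol T ∧ S ⊆ T
  contains_essential : (optSize Sol : ℤ) = k → ∀ v : V, IsEssential c Sol v → v ∈ S

end Essential

/-! ### Directed Odd Cycle Transversal -/

/-- A directed cycle of `D`: a cyclic sequence of distinct vertices in which each vertex has an arc
to the next one. -/
def Digraph.IsDirectedCycle {V : Type*} (D : Digraph V) (C : Cycle V) : Prop :=
  C.Nodup ∧ C.Chain D.Adj

/-- `S` meets each directed cycle of odd length; that is, `D - S` has no such cycle. -/
def Digraph.IsOddCycleTransversal {V : Type*} (D : Digraph V) (S : Finset V) : Prop :=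
  ∀ C : Cycle V, D.IsDirectedCycle C → Odd C.length → ∃ v ∈ C, v ∈ S

/-- An instance of Essential Detection for Directed Odd Cycle Transversal: a finite simple digraph
(opposite arcs are allowed, loops are not) on the vertices `0, …, n - 1`, and an integer `k`. -/
structure DOCTInstance : Type where
  n : ℕ
  D : Digraph (Fin n)
  loopless : ∀ v : Fin n, ¬ D.Adj v v
  k : ℤ

open Classical in
/-- The encoding of an instance: `n`, the positive and the negative part of `k`, and the adjacency
matrix of `D` row by row. -/
noncomputable def DOCTInstance.encode (I : DOCTInstance) : List ℕ :=
  I.n :: I.k.toNat :: (-I.k).toNat ::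
    List.ofFn fun e : Fin (I.n * I.n) => if I.D.Adj e.divNat e.modNat then 1 else 0

/-- The vertex set that is read off from the memory `mem`: vertex `v` belongs to it if and only if
memory cell number `v` is not zero. -/
def outputSet (n : ℕ) (mem : ℕ → ℕ) : Finset (Fin n) :=
  Finset.univ.filter fun v => mem (v : ℕ) ≠ 0

/-! ### A language of bounded loops, compiled to random access machines -/

namespace LoopLang

/-! Fix a vertex v. Split each vertex u into an entrance and an exit for each of two parities;
entrance to exit costs 1 (no such arc for v itself), and an arc of the digraph joins an exit to the
entrance of opposite parity at the prohibitive price 2n + 1. Paths from the even exit of v to its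
odd entrance are the closed walks of odd length through v. Let f(v) be the minimum cut between these
two nodes, capped at 2n + 1. The output is the set of v with f(v) > 2k, where a negative k is read
as 0.

If a transversal T avoids v, cutting both copies of each vertex of T gives f(v) ≤ 2|T|
(`exists_cut_of_transversal`). So for opt ≤ k the output lies in every optimal transversal.
Conversely, suppose opt = k, f(v) ≤ 2k and v lies in an optimal T. A minimum cut yields a set X with
|X| ≤ 2k, not containing v, that meets all odd cycles through v (`exists_hitting_of_cut`). Then (T ∖
{v}) ∪ X is a transversal of size at most 3k that avoids v, so v is not 3-essential. Both halves
meet in `isEssentialDetectionOutput_of_isCutValue`.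

For the running time, f is computed by augmenting paths in a language whose only iteration is a loop
with a bound fixed on entry. `Cmd.runsWithin_time` bounds the cost of the compiled code by a
polynomial in the loop bounds n, 4n and 2n + 1. Correctness of the flow computation never mentions
flows: `improve_spec` follows the capacities of all separating cuts in the residual network. -/

/-- The state of a loop program: the values of its variables, and the memory. -/
@[ext] structure State : Type where
  v : ℕ → ℕ
  m : ℕ → ℕ

/-- Assign a value to a variable. -/
def State.set (σ : State) (x a : ℕ) : State := ⟨Function.update σ.v x a, σ.m⟩

/-- Assign a value to a memory cell. -/
def State.put (σ : State) (i a : ℕ) : State := ⟨σ.v, Function.update σ.m i a⟩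

@[simp] theorem State.set_v (σ : State) (x a y : ℕ) :
    (σ.set x a).v y = if y = x then a else σ.v y := by
  simp [State.set, Function.update_apply]

@[simp] theorem State.set_m (σ : State) (x a : ℕ) : (σ.set x a).m = σ.m := rfl

@[simp] theorem State.put_v (σ : State) (i a : ℕ) : (σ.put i a).v = σ.v := rfl

@[simp] theorem State.put_m (σ : State) (i a j : ℕ) :
    (σ.put i a).m j = if j = i then a else σ.m j := by
  simp [State.put, Function.update_apply]

/-- Expressions: literals, variables, sums, truncated differences and memory access. -/
inductive Expr : Type
  | lit (c : ℕ)
  | var (x : ℕ)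
  | add (e f : Expr)
  | sub (e f : Expr)
  | get (e : Expr)

/-- The value of an expression. -/
@[simp] def Expr.eval (σ : State) : Expr → ℕ
  | .lit c => c
  | .var x => σ.v x
  | .add e f => e.eval σ + f.eval σ
  | .sub e f => e.eval σ - f.eval σ
  | .get e => σ.m (e.eval σ)

/-- Loop programs. The command `loop x y c` executes `c` for `x = 0, …, y - 1`. -/
inductive Cmd : Type
  | skip
  | assign (x : ℕ) (e : Expr)
  | store (e f : Expr)
  | seq (c d : Cmd)
  | ite (e : Expr) (c d : Cmd)
  | loop (x y : ℕ) (c : Cmd)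

/-- The effect of a loop program. -/
def Cmd.eval : Cmd → State → State
  | .skip, σ => σ
  | .assign x e, σ => σ.set x (e.eval σ)
  | .store e f, σ => σ.put (e.eval σ) (f.eval σ)
  | .seq c d, σ => d.eval (c.eval σ)
  | .ite e c d, σ => if 0 < e.eval σ then c.eval σ else d.eval σ
  | .loop x y c, σ => (fun τ => (c.eval τ).set x ((c.eval τ).v x + 1))^[σ.v y] (σ.set x 0)

/-- The variables to which a loop program may assign. -/
def Cmd.writes : Cmd → List ℕ
  | .skip => []
  | .assign x _ => [x]
  | .store _ _ => []
  | .seq c d => c.writes ++ d.writes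
  | .ite _ c d => c.writes ++ d.writes
  | .loop x _ c => x :: c.writes

/-- The variables which bound the loops of a loop program. -/
def Cmd.bounds : Cmd → List ℕ
  | .skip => []
  | .assign _ _ => []
  | .store _ _ => []
  | .seq c d => c.bounds ++ d.bounds
  | .ite _ c d => c.bounds ++ d.bounds
  | .loop _ y c => y :: c.bounds

/-- The body of a loop does not change the variables that control the loop. -/
def Cmd.WellFormed : Cmd → Prop
  | .skip => True
  | .assign _ _ => True
  | .store _ _ => True
  | .seq c d => c.WellFormed ∧ d.WellFormed
  | .ite _ c d => c.WellFormed ∧ d.WellFormed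
  | .loop x y c => x ≠ y ∧ x ∉ c.writes ∧ y ∉ c.writes ∧ c.WellFormed

instance Cmd.decidableWellFormed : ∀ c : Cmd, Decidable c.WellFormed
  | .skip => isTrue trivial
  | .assign _ _ => isTrue trivial
  | .store _ _ => isTrue trivial
  | .seq c d =>
    have := c.decidableWellFormed
    have := d.decidableWellFormed
    inferInstanceAs (Decidable (_ ∧ _))
  | .ite _ c d =>
    have := c.decidableWellFormed
    have := d.decidableWellFormed
    inferInstanceAs (Decidable (_ ∧ _))
  | .loop _ _ c =>
    have := c.decidableWellFormed
    inferInstanceAs (Decidable (_ ∧ _))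

/-- The frame rule. Since `writes` is a computable list, most uses are settled by `decide`. -/
theorem Cmd.eval_v_of_notMem {z : ℕ} :
    ∀ (c : Cmd) (σ : State), z ∉ c.writes → (c.eval σ).v z = σ.v z
  | .skip, _, _ => rfl
  | .assign x e, σ, h => by simp_all [Cmd.eval, Cmd.writes]
  | .store e f, σ, h => by simp [Cmd.eval]
  | .seq c d, σ, h => by
    simp only [Cmd.writes, List.mem_append, not_or] at h
    rw [Cmd.eval, d.eval_v_of_notMem _ h.2, c.eval_v_of_notMem _ h.1]
  | .ite e c d, σ, h => by
    simp only [Cmd.writes, List.mem_append, not_or] at h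
    rw [Cmd.eval]
    split
    · exact c.eval_v_of_notMem _ h.1
    · exact d.eval_v_of_notMem _ h.2
  | .loop x y c, σ, h => by
    simp only [Cmd.writes, List.mem_cons, not_or] at h
    rw [Cmd.eval]
    generalize σ.v y = k
    induction k with
    | zero => simp [h.1]
    | succ k ih =>
      rw [Function.iterate_succ_apply', State.set_v, if_neg h.1, c.eval_v_of_notMem _ h.2, ih]

/-- The rule for loops: an invariant that holds at the start and is preserved by the body holds at
the end. The variables which the loop does not change may be used freely. -/
theorem Cmd.eval_loop_induction {x y : ℕ} {c : Cmd} {σ : State} (I : ℕ → State → Prop)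
    (hx : x ∉ c.writes) (h0 : I 0 (σ.set x 0))
    (hs : ∀ i < σ.v y, ∀ τ : State, τ.v x = i → (∀ z, z ∉ x :: c.writes → τ.v z = σ.v z) → I i τ →
      I (i + 1) ((c.eval τ).set x (i + 1))) :
    I (σ.v y) ((Cmd.loop x y c).eval σ) := by
  rw [Cmd.eval]
  have key : ∀ k ≤ σ.v y,
      (((fun τ => (c.eval τ).set x ((c.eval τ).v x + 1))^[k] (σ.set x 0)).v x = k ∧
        ∀ z, z ∉ x :: c.writes →
          ((fun τ => (c.eval τ).set x ((c.eval τ).v x + 1))^[k] (σ.set x 0)).v z = σ.v z) ∧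
        I k ((fun τ => (c.eval τ).set x ((c.eval τ).v x + 1))^[k] (σ.set x 0)) := by
    intro k
    induction k with
    | zero =>
      intro _
      refine ⟨⟨by simp, fun z hz => ?_⟩, h0⟩
      simp only [List.mem_cons, not_or] at hz
      simp [hz.1]
    | succ k ih =>
      intro hk
      obtain ⟨⟨h1, h2⟩, h3⟩ := ih (by omega)
      rw [Function.iterate_succ_apply']
      generalize ((fun τ => (c.eval τ).set x ((c.eval τ).v x + 1))^[k] (σ.set x 0)) = τ at *
      have h4 := c.eval_v_of_notMem τ hx
      refine ⟨⟨by simp [h4, h1], fun z hz => ?_⟩, ?_⟩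
      · have hz' := hz
        simp only [List.mem_cons, not_or] at hz
        rw [State.set_v, if_neg hz.1, c.eval_v_of_notMem _ hz.2, h2 z hz']
      · simp only [h4, h1]
        exact hs k (by omega) τ h1 h2 h3
  exact (key _ le_rfl).2

/-! #### Compilation -/

open RAM (Instr Program Config step)

/-- Code that computes the value of an expression in register `2 * d + 1`. The registers with odd
numbers are scratch space, the variable `x` lives in register `2 * x`. -/
def Expr.compile : Expr → ℕ → Program
  | .lit c, d => [.const (2 * d + 1) c]
  -- There is no copy instruction: a value is moved by adding a register just set to zero.
  | .var x, d => [.const (2 * d + 1) 0, .add (2 * d + 1) (2 * x) (2 * d + 1)]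
  | .add e f, d => e.compile d ++ (f.compile (d + 1) ++ [.add (2 * d + 1) (2 * d + 1) (2 * d + 3)])
  | .sub e f, d => e.compile d ++ (f.compile (d + 1) ++ [.sub (2 * d + 1) (2 * d + 1) (2 * d + 3)])
  | .get e, d => e.compile d ++ [.load (2 * d + 1) (2 * d + 1)]

/-- The number of instructions in the code of a loop program. -/
def Cmd.size : Cmd → ℕ
  | .skip => 0
  | .assign _ e => (e.compile 0).length + 2
  | .store e f => (e.compile 0).length + ((f.compile 1).length + 1)
  | .seq c d => c.size + d.size
  | .ite e c d => (e.compile 0).length + (1 + (d.size + (2 + c.size)))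
  | .loop _ _ c => 5 + (c.size + 3)

/-- The code of a loop program, to be placed at address `o`. -/
def Cmd.compile : Cmd → ℕ → Program
  | .skip, _ => []
  | .assign x e, _ => e.compile 0 ++ [.const 3 0, .add (2 * x) 1 3]
  | .store e f, _ => e.compile 0 ++ (f.compile 1 ++ [.store 1 3])
  | .seq c d, o => c.compile o ++ d.compile (o + c.size)
  | .ite e c d, o => e.compile 0 ++
      ([.jumpPos 1 (o + (e.compile 0).length + 1 + d.size + 2)] ++
        (d.compile (o + (e.compile 0).length + 1) ++
          ([.const 1 1, .jumpPos 1 (o + (e.compile 0).length + 1 + d.size + 2 + c.size)] ++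
            c.compile (o + (e.compile 0).length + 1 + d.size + 2))))
  | .loop x y c, o =>
      -- The truncated difference of bound and counter is positive while rounds remain. Loading 1
      -- into register 1 makes the following `jumpPos` unconditional.
      [.const (2 * x) 0, .sub 1 (2 * y) (2 * x), .jumpPos 1 (o + 5), .const 1 1,
        .jumpPos 1 (o + 5 + c.size + 3)] ++
        (c.compile (o + 5) ++ [.const 1 1, .add (2 * x) (2 * x) 1, .jumpPos 1 (o + 1)])

theorem Cmd.length_compile : ∀ (c : Cmd) (o : ℕ), (c.compile o).length = c.size
  | .skip, _ => rfl
  | .assign _ _, _ => by simp [Cmd.compile, Cmd.size]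
  | .store _ _, _ => by simp [Cmd.compile, Cmd.size]
  | .seq c d, o => by simp [Cmd.compile, Cmd.size, c.length_compile, d.length_compile]
  | .ite e c d, o => by
    simp [Cmd.compile, Cmd.size, c.length_compile, d.length_compile]; omega
  | .loop x y c, o => by simp [Cmd.compile, Cmd.size, c.length_compile]; omega

/-- The program `P` contains `code` at address `o`. -/
def CodeAt (P : Program) (o : ℕ) (code : Program) : Prop :=
  ∀ i x, code[i]? = some x → P[o + i]? = some x

theorem CodeAt.left {P : Program} {o : ℕ} {c d : Program} (h : CodeAt P o (c ++ d)) :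
    CodeAt P o c := fun i x hi =>
  h i x (by rw [List.getElem?_append_left (List.getElem?_eq_some_iff.1 hi).1, hi])

theorem CodeAt.right {P : Program} {o : ℕ} {c d : Program} (h : CodeAt P o (c ++ d)) :
    CodeAt P (o + c.length) d := fun i x hi => by
  rw [add_assoc]
  exact h _ x (by rw [List.getElem?_append_right (by omega)]; simpa using hi)

theorem CodeAt.tail {P : Program} {o : ℕ} {a : Instr} {d : Program} (h : CodeAt P o (a :: d)) :
    CodeAt P (o + 1) d := CodeAt.right (c := [a]) h

theorem CodeAt.step {P : Program} {o : ℕ} {a : Instr} {d : Program} (h : CodeAt P o (a :: d))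
    (C : Config) (hC : C.pc = o) : RAM.step P C = a.exec C := by
  have := h 0 a rfl
  rw [add_zero] at this
  rw [RAM.step, hC, this]

/-- The machine configuration `C` with program counter `o` represents the state `σ`. -/
structure Represents (C : Config) (o : ℕ) (σ : State) : Prop where
  pc : C.pc = o
  reg : ∀ x, C.reg (2 * x) = σ.v x
  mem : C.mem = σ.m

theorem Represents.exec_jumpPos {C : Config} {o : ℕ} {σ : State} (hC : Represents C o σ)
    (j l : ℕ) : Represents (Instr.exec C (.jumpPos j l)) (if 0 < C.reg j then l else o + 1) σ :=
  ⟨by simp [Instr.exec, hC.pc], hC.reg, hC.mem⟩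

theorem Represents.exec_const_odd {C : Config} {o : ℕ} {σ : State} (hC : Represents C o σ)
    (j a : ℕ) (hj : j % 2 = 1) : Represents (Instr.exec C (.const j a)) (o + 1) σ :=
  ⟨by simp [Instr.exec, hC.pc], fun x => by
    simp only [Instr.exec, Function.update_apply]; rw [if_neg (by omega), hC.reg], hC.mem⟩

/-- The odd registers serve as a stack: code at depth `d` leaves the scratch registers below `d`
alone, so a left operand survives the evaluation of the right one at depth `d + 1`. -/
theorem Expr.compile_spec {P : Program} : ∀ (e : Expr) (d o : ℕ) (C : Config) (σ : State),
    CodeAt P o (e.compile d) → Represents C o σ →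
    ∃ C', (step P)^[(e.compile d).length] C = C' ∧ Represents C' (o + (e.compile d).length) σ ∧
      C'.reg (2 * d + 1) = e.eval σ ∧ ∀ i < d, C'.reg (2 * i + 1) = C.reg (2 * i + 1)
  | .lit c, d, o, C, σ, h, hC => by
    refine ⟨_, rfl, ?_⟩
    simp only [Expr.compile, List.length_singleton, Function.iterate_one, h.step C hC.pc,
      Instr.exec]
    refine ⟨⟨by simp [hC.pc], fun x => ?_, hC.mem⟩, by simp, fun i hi => ?_⟩
    · simp only [Function.update_apply]
      rw [if_neg (by omega), hC.reg]
    · simp only [Function.update_apply]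
      rw [if_neg (by omega)]
  | .var x, d, o, C, σ, h, hC => by
    refine ⟨_, rfl, ?_⟩
    have r1 := hC.exec_const_odd (2 * d + 1) 0 (by omega)
    simp only [Expr.compile, List.length_cons, List.length_nil, Function.iterate_succ_apply,
      Function.iterate_zero, id, h.step C hC.pc, h.tail.step _ r1.pc]
    simp only [Instr.exec]
    refine ⟨⟨by simp [hC.pc], fun y => ?_, hC.mem⟩, ?_, fun i hi => ?_⟩
    · simp only [Function.update_apply]
      rw [if_neg (by omega), if_neg (by omega), hC.reg]
    · simp only [Function.update_self]
      rw [Function.update_of_ne (by omega), hC.reg, add_zero, Expr.eval]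
    · simp only [Function.update_apply]
      rw [if_neg (by omega), if_neg (by omega)]
  | .add e f, d, o, C, σ, h, hC => by
    obtain ⟨C₁, h1, hC1, hr1, hf1⟩ := e.compile_spec d o C σ h.left hC
    obtain ⟨C₂, h2, hC2, hr2, hf2⟩ := f.compile_spec (d + 1) _ C₁ σ h.right.left hC1
    refine ⟨_, rfl, ?_⟩
    have hl : (Expr.compile (.add e f) d).length =
      1 + ((f.compile (d + 1)).length + (e.compile d).length) := by simp [Expr.compile]; omega
    rw [hl, Function.iterate_add_apply, Function.iterate_add_apply, h1, h2, Function.iterate_one,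
      h.right.right.step C₂ hC2.pc]
    simp only [Instr.exec]
    refine ⟨⟨by simp only [hC2.pc]; omega, fun y => ?_, hC2.mem⟩, ?_, fun i hi => ?_⟩
    · simp only [Function.update_apply]
      rw [if_neg (by omega), hC2.reg]
    · have := hf2 d (by omega)
      rw [show 2 * (d + 1) + 1 = 2 * d + 3 by ring] at hr2
      simp [this, hr1, hr2]
    · simp only [Function.update_apply]
      rw [if_neg (by omega), hf2 i (by omega), hf1 i hi]
  | .sub e f, d, o, C, σ, h, hC => by
    obtain ⟨C₁, h1, hC1, hr1, hf1⟩ := e.compile_spec d o C σ h.left hC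
    obtain ⟨C₂, h2, hC2, hr2, hf2⟩ := f.compile_spec (d + 1) _ C₁ σ h.right.left hC1
    refine ⟨_, rfl, ?_⟩
    have hl : (Expr.compile (.sub e f) d).length =
      1 + ((f.compile (d + 1)).length + (e.compile d).length) := by simp [Expr.compile]; omega
    rw [hl, Function.iterate_add_apply, Function.iterate_add_apply, h1, h2, Function.iterate_one,
      h.right.right.step C₂ hC2.pc]
    simp only [Instr.exec]
    refine ⟨⟨by simp only [hC2.pc]; omega, fun y => ?_, hC2.mem⟩, ?_, fun i hi => ?_⟩
    · simp only [Function.update_apply]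
      rw [if_neg (by omega), hC2.reg]
    · have := hf2 d (by omega)
      rw [show 2 * (d + 1) + 1 = 2 * d + 3 by ring] at hr2
      simp [this, hr1, hr2]
    · simp only [Function.update_apply]
      rw [if_neg (by omega), hf2 i (by omega), hf1 i hi]
  | .get e, d, o, C, σ, h, hC => by
    obtain ⟨C₁, h1, hC1, hr1, hf1⟩ := e.compile_spec d o C σ h.left hC
    refine ⟨_, rfl, ?_⟩
    have hl : (Expr.compile (.get e) d).length = 1 + (e.compile d).length := by
      simp [Expr.compile]; omega
    rw [hl, Function.iterate_add_apply, h1, Function.iterate_one, h.right.step C₁ hC1.pc]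
    simp only [Instr.exec]
    refine ⟨⟨by simp only [hC1.pc]; omega, fun y => ?_, hC1.mem⟩, ?_, fun i hi => ?_⟩
    · simp only [Function.update_apply]
      rw [if_neg (by omega), hC1.reg]
    · simp [hr1, hC1.mem]
    · simp only [Function.update_apply]
      rw [if_neg (by omega), hf1 i hi]

/-- The code of `c`, started in the state `σ`, reaches the final state of `c` within `T` steps. -/
def Cmd.RunsWithin (c : Cmd) (σ : State) (T : ℕ) : Prop :=
  ∀ (P : Program) (o : ℕ), CodeAt P o (c.compile o) → ∀ C, Represents C o σ →
    ∃ t ≤ T, Represents ((step P)^[t] C) (o + c.size) (c.eval σ)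

theorem Cmd.runsWithin_skip (σ : State) : Cmd.skip.RunsWithin σ 0 := fun _ _ _ _ hC =>
  ⟨0, le_rfl, hC⟩

theorem Cmd.runsWithin_assign (x : ℕ) (e : Expr) (σ : State) :
    (Cmd.assign x e).RunsWithin σ ((e.compile 0).length + 2) := by
  intro P o h C hC
  obtain ⟨C₁, h1, hC1, hr1, -⟩ := e.compile_spec 0 o C σ h.left hC
  refine ⟨_, le_rfl, ?_⟩
  have r1 := hC1.exec_const_odd 3 0 (by norm_num)
  rw [add_comm, Function.iterate_add_apply, h1]
  simp only [Function.iterate_succ_apply, Function.iterate_zero, id, h.right.step C₁ hC1.pc,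
    h.right.tail.step _ r1.pc]
  simp only [Instr.exec]
  refine ⟨by simp only [hC1.pc, Cmd.size]; omega, fun y => ?_, hC1.mem⟩
  have : C₁.reg 1 = e.eval σ := hr1
  by_cases hy : y = x
  · subst hy; simp [Cmd.eval, this]
  · simp only [Function.update_apply]
    rw [if_neg (by omega), if_neg (by omega), hC1.reg]
    simp [Cmd.eval, hy]

theorem Cmd.runsWithin_store (e f : Expr) (σ : State) :
    (Cmd.store e f).RunsWithin σ ((e.compile 0).length + ((f.compile 1).length + 1)) := by
  intro P o h C hC
  obtain ⟨C₁, h1, hC1, hr1, -⟩ := e.compile_spec 0 o C σ h.left hC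
  obtain ⟨C₂, h2, hC2, hr2, hf2⟩ := f.compile_spec 1 _ C₁ σ h.right.left hC1
  refine ⟨_, le_rfl, ?_⟩
  rw [add_comm, add_comm _ 1, Function.iterate_add_apply, Function.iterate_add_apply, h1, h2,
    Function.iterate_one, h.right.right.step C₂ hC2.pc]
  have h3 : C₂.reg 1 = e.eval σ := (hf2 0 one_pos).trans hr1
  have h4 : C₂.reg 3 = f.eval σ := hr2
  simp only [Instr.exec]
  exact ⟨by simp only [hC2.pc, Cmd.size]; omega, hC2.reg, by
    simp [Cmd.eval, State.put, h3, h4, hC2.mem]⟩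

theorem Cmd.RunsWithin.seq {c d : Cmd} {σ : State} {T₁ T₂ : ℕ} (hc : c.RunsWithin σ T₁)
    (hd : d.RunsWithin (c.eval σ) T₂) : (Cmd.seq c d).RunsWithin σ (T₁ + T₂) := by
  intro P o h C hC
  obtain ⟨t₁, ht₁, h1⟩ := hc P o h.left C hC
  have h' := h.right
  rw [c.length_compile] at h'
  obtain ⟨t₂, ht₂, h2⟩ := hd P _ h' _ h1
  refine ⟨t₂ + t₁, by omega, ?_⟩
  rw [Function.iterate_add_apply, Cmd.size, ← add_assoc]
  exact h2

theorem Cmd.RunsWithin.ite {e : Expr} {c d : Cmd} {σ : State} {T₁ T₂ : ℕ} (hc : c.RunsWithin σ T₁)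
    (hd : d.RunsWithin σ T₂) :
    (Cmd.ite e c d).RunsWithin σ ((e.compile 0).length + (T₁ + T₂ + 3)) := by
  intro P o h C hC
  obtain ⟨C₁, h1, hC1, hr1, -⟩ := e.compile_spec 0 o C σ h.left hC
  have hr1 : C₁.reg 1 = e.eval σ := hr1
  have hj := h.right.left.step C₁ hC1.pc
  have hJ := hC1.exec_jumpPos 1 (o + (e.compile 0).length + 1 + d.size + 2)
  rw [← hj] at hJ
  rw [Cmd.eval]
  by_cases hp : 0 < e.eval σ
  · rw [hr1, if_pos hp] at hJ
    rw [if_pos hp]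
    have h' := h.right.right.right.right
    simp only [d.length_compile, List.length_cons, List.length_nil] at h'
    obtain ⟨t, ht, h2⟩ := hc P _ h' _ hJ
    refine ⟨t + (1 + (e.compile 0).length), by omega, ?_⟩
    rw [Function.iterate_add_apply, Function.iterate_add_apply, h1, Function.iterate_one]
    convert h2 using 1
    simp only [Cmd.size]; omega
  · rw [hr1, if_neg hp] at hJ
    rw [if_neg hp]
    obtain ⟨t, ht, h2⟩ := hd P _ h.right.right.left _ hJ
    have h' := h.right.right.right.left
    simp only [d.length_compile, List.length_cons, List.length_nil] at h'
    refine ⟨2 + (t + (1 + (e.compile 0).length)), by omega, ?_⟩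
    rw [Function.iterate_add_apply, Function.iterate_add_apply, Function.iterate_add_apply, h1,
      Function.iterate_one]
    have h3 := h2.exec_const_odd 1 1 (by norm_num)
    have h4 := h3.exec_jumpPos 1 (o + (e.compile 0).length + 1 + d.size + 2 + c.size)
    simp only [Function.iterate_succ_apply, Function.iterate_zero, id, h'.step _ h2.pc,
      h'.tail.step _ h3.pc]
    convert h4 using 1
    simp only [Instr.exec, Function.update_self, Cmd.size]
    rw [if_pos one_pos]; omega

/-- A round costs the body, two steps for the test and three for increment and jump back. The final
5 pays for the initialization, the failing test and the exit jump. -/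
theorem Cmd.RunsWithin.loop {x y : ℕ} {c : Cmd} {σ : State} {T B : ℕ} (hxy : x ≠ y)
    (hx : x ∉ c.writes) (hy : y ∉ c.writes) (hB : σ.v y ≤ B)
    (hc : ∀ τ : State, (∀ z, z ∉ x :: c.writes → τ.v z = σ.v z) → c.RunsWithin τ T) :
    (Cmd.loop x y c).RunsWithin σ (B * (T + 5) + 5) := by
  intro P o h C hC
  have h1 := h.left.step C hC.pc
  have hC1 : Represents (Instr.exec C (.const (2 * x) 0)) (o + 1) (σ.set x 0) :=
    ⟨by simp [Instr.exec, hC.pc], fun z => by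
      simp only [Instr.exec, Function.update_apply, hC.reg, State.set_v]
      by_cases hz : z = x <;> simp [hz], hC.mem⟩
  rw [← h1] at hC1
  have hb := h.right.left
  have ht := h.right.right
  simp only [c.length_compile, List.length_cons, List.length_nil] at hb ht
  set body : State → State := fun τ => (c.eval τ).set x ((c.eval τ).v x + 1) with hbody
  have test : ∀ (τ : State) (C' : Config), Represents C' (o + 1) τ →
      Represents ((step P)^[2] C') (if 0 < τ.v y - τ.v x then o + 5 else o + 3) τ := by
    intro τ C' hC'
    have e1 := h.left.tail.step C' hC'.pc
    have r1 : Represents (Instr.exec C' (.sub 1 (2 * y) (2 * x))) (o + 2) τ :=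
      ⟨by simp [Instr.exec, hC'.pc], fun z => by
        simp only [Instr.exec, Function.update_apply]; rw [if_neg (by omega), hC'.reg], hC'.mem⟩
    have r2 := r1.exec_jumpPos 1 (o + 5)
    simp only [Function.iterate_succ_apply, Function.iterate_zero, id, e1,
      h.left.tail.tail.step _ r1.pc]
    convert r2 using 1
    simp [Instr.exec, hC'.reg]
  have key : ∀ k ≤ σ.v y, ∃ t ≤ k * (T + 5),
      Represents ((step P)^[t] (step P C)) (o + 1) (body^[k] (σ.set x 0)) ∧
        (body^[k] (σ.set x 0)).v x = k ∧
        ∀ z, z ∉ x :: c.writes → (body^[k] (σ.set x 0)).v z = σ.v z := by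
    intro k
    induction k with
    | zero =>
      intro _
      refine ⟨0, by simp, hC1, by simp, fun z hz => ?_⟩
      simp only [List.mem_cons, not_or] at hz
      simp [hz.1]
    | succ k ih =>
      intro hk
      obtain ⟨t, htk, hr, hvx, hfr⟩ := ih (by omega)
      rw [Function.iterate_succ_apply']
      generalize body^[k] (σ.set x 0) = τ at *
      have r1 := test τ _ hr
      have hvy : τ.v y = σ.v y := hfr y (by simp [hxy.symm, hy])
      rw [if_pos (by omega)] at r1
      obtain ⟨t', ht', r2⟩ := hc τ hfr P (o + 5) hb _ r1
      have r3 := r2.exec_const_odd 1 1 (by norm_num)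
      have r4 : Represents (Instr.exec (Instr.exec ((step P)^[t'] ((step P)^[2] ((step P)^[t]
          (step P C)))) (.const 1 1)) (.add (2 * x) (2 * x) 1)) (o + 5 + c.size + 1 + 1)
          (body τ) := by
        refine ⟨by simp only [Instr.exec, r2.pc], fun z => ?_, r3.mem⟩
        have e1 := r2.reg x
        have e2 := r2.reg z
        by_cases hz : z = x
        · subst hz
          simp only [Instr.exec, Function.update_self, hbody, State.set_v, if_true]
          rw [Function.update_of_ne (by omega), e1]
        · simp only [Instr.exec, hbody, State.set_v, if_neg hz]
          rw [Function.update_of_ne (by omega), Function.update_of_ne (by omega), e2]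
      have r5 := r4.exec_jumpPos 1 (o + 1)
      refine ⟨3 + (t' + (2 + t)), by rw [add_mul]; omega, ?_, ?_, ?_⟩
      · simp only [Function.iterate_add_apply]
        rw [Function.iterate_succ_apply, Function.iterate_succ_apply, Function.iterate_one,
          ht.step _ r2.pc, ht.tail.step _ r3.pc, ht.tail.tail.step _ r4.pc]
        convert r5 using 1
        rw [if_pos]
        simp only [Instr.exec]
        rw [Function.update_of_ne (by omega), Function.update_self]
        exact one_pos
      · simp [hbody, c.eval_v_of_notMem τ hx, hvx]
      · intro z hz
        have hz' := hz
        simp only [List.mem_cons, not_or] at hz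
        simp only [hbody]
        rw [State.set_v, if_neg hz.1, c.eval_v_of_notMem _ hz.2, hfr z hz']
  obtain ⟨t, htk, hr, hvx, hfr⟩ := key _ le_rfl
  have r1 := test _ _ hr
  rw [hvx, hfr y (by simp [hxy.symm, hy]), if_neg (by omega)] at r1
  have r2 := r1.exec_const_odd 1 1 (by norm_num)
  have r3 := r2.exec_jumpPos 1 (o + 5 + c.size + 3)
  have hm := Nat.mul_le_mul_right (T + 5) hB
  refine ⟨2 + (2 + (t + 1)), by omega, ?_⟩
  simp only [Function.iterate_add_apply _ 2, Function.iterate_add_apply _ t, Function.iterate_one]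
  rw [Function.iterate_succ_apply, Function.iterate_one, h.left.tail.tail.tail.step _ r1.pc,
    h.left.tail.tail.tail.tail.step _ r2.pc]
  convert r3 using 1
  · simp only [Instr.exec, Function.update_self, Cmd.size]
    rw [if_pos one_pos]; omega
  · rfl

/-- A bound on the running time of a loop program, as a polynomial in a bound on the values of the
variables that control its loops. -/
noncomputable def Cmd.time : Cmd → Polynomial ℕ
  | .skip => 0
  | .assign _ e => Polynomial.C ((e.compile 0).length + 2)
  | .store e f => Polynomial.C ((e.compile 0).length + ((f.compile 1).length + 1))
  | .seq c d => c.time + d.time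
  | .ite e c d => Polynomial.C (e.compile 0).length + (c.time + d.time + 3)
  | .loop _ _ c => Polynomial.X * (c.time + 5) + 5

/-- The bounding variables are written nowhere in the program, so a bound that holds at the start
still holds whenever a loop is entered. -/
theorem Cmd.runsWithin_time {B : ℕ} : ∀ (c : Cmd) (σ : State), c.WellFormed →
    (∀ y ∈ c.bounds, y ∉ c.writes ∧ σ.v y ≤ B) → c.RunsWithin σ (c.time.eval B)
  | .skip, σ, _, _ => by simpa [Cmd.time] using runsWithin_skip σ
  | .assign x e, σ, _, _ => by simpa [Cmd.time] using runsWithin_assign x e σ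
  | .store e f, σ, _, _ => by simpa [Cmd.time] using runsWithin_store e f σ
  | .seq c d, σ, hw, h => by
    simp only [Cmd.bounds, Cmd.writes, List.mem_append, not_or] at h
    rw [Cmd.time, Polynomial.eval_add]
    refine (c.runsWithin_time σ hw.1 fun y hy => ?_).seq
      (d.runsWithin_time _ hw.2 fun y hy => ?_)
    · exact ⟨(h y (Or.inl hy)).1.1, (h y (Or.inl hy)).2⟩
    · refine ⟨(h y (Or.inr hy)).1.2, ?_⟩
      rw [c.eval_v_of_notMem _ (h y (Or.inr hy)).1.1]
      exact (h y (Or.inr hy)).2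
  | .ite e c d, σ, hw, h => by
    simp only [Cmd.bounds, Cmd.writes, List.mem_append, not_or] at h
    have := (c.runsWithin_time (B := B) σ hw.1 fun y hy =>
      ⟨(h y (Or.inl hy)).1.1, (h y (Or.inl hy)).2⟩).ite (e := e)
      (d.runsWithin_time (B := B) σ hw.2 fun y hy =>
      ⟨(h y (Or.inr hy)).1.2, (h y (Or.inr hy)).2⟩)
    simpa [Cmd.time] using this
  | .loop x y c, σ, hw, h => by
    obtain ⟨hxy, hx, hy, hw⟩ := hw
    simp only [Cmd.bounds, Cmd.writes] at h
    have := Cmd.RunsWithin.loop (T := c.time.eval B) hxy hx hy (h y (by simp)).2 fun τ hτ =>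
      c.runsWithin_time (B := B) τ hw fun z hz => by
        have hz := h z (by simp [hz])
        rw [hτ z hz.1]
        exact ⟨fun hc => hz.1 (by simp [hc]), hz.2⟩
    simpa [Cmd.time] using this

end LoopLang

/-! ### Cuts in the split bipartite double cover -/

namespace DOCT

open Finset

/-! ### Closed walks and odd cycles. -/

section Walks

variable {V : Type*} {r : V → V → Prop}

theorem exists_append_cons_append_cons_of_not_nodup {l : List V} (h : ¬ l.Nodup) :
    ∃ a l₁ l₂ l₃, l = l₁ ++ (a :: l₂ ++ a :: l₃) := by
  induction l with
  | nil => simp at h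
  | cons b l ih =>
    by_cases hb : b ∈ l
    · obtain ⟨l₂, l₃, rfl⟩ := List.append_of_mem hb
      exact ⟨b, [], l₂, l₃, rfl⟩
    · obtain ⟨a, l₁, l₂, l₃, rfl⟩ := ih fun hl => h (List.nodup_cons.2 ⟨hb, hl⟩)
      exact ⟨a, b :: l₁, l₂, l₃, rfl⟩

/-- A closed walk of odd length contains a directed cycle of odd length. -/
theorem exists_odd_cycle_of_odd_closed_walk (l : List V)
    (hl : (l : Cycle V).Chain r) (ho : Odd l.length) :
    ∃ C : Cycle V, C.Nodup ∧ C.Chain r ∧ Odd C.length ∧ ∀ x ∈ C, x ∈ l := by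
  induction hn : l.length using Nat.strong_induction_on generalizing l with
  | _ n ih =>
    by_cases hd : l.Nodup
    · exact ⟨l, by simpa using hd, hl, by simpa using ho, fun x hx => by simpa using hx⟩
    -- A repeated vertex `a` splits the rotated closed walk into two shorter closed walks at `a`;
    -- their lengths add up to an odd number, so one of them is odd.
    · obtain ⟨a, l₁, l₂, l₃, rfl⟩ := exists_append_cons_append_cons_of_not_nodup hd
      have hrot : ((l₁ ++ (a :: l₂ ++ a :: l₃) : List V) : Cycle V) =
          ((a :: (l₂ ++ a :: (l₃ ++ l₁)) : List V) : Cycle V) := by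
        rw [Cycle.coe_eq_coe]
        convert List.isRotated_append using 1
        simp
      rw [hrot, Cycle.chain_coe_cons] at hl
      have hl' : List.IsChain r ((a :: l₂) ++ a :: (l₃ ++ l₁ ++ [a])) := by simpa using hl
      rw [List.isChain_split] at hl'
      simp only [List.length_append, List.length_cons] at ho hn
      rcases Nat.even_or_odd (l₂.length + 1) with he | he
      · obtain ⟨C, h1, h2, h3, h4⟩ := ih (l₃ ++ l₁).length.succ (by simp; omega)
          (a :: (l₃ ++ l₁)) (by rw [Cycle.chain_coe_cons]; exact hl'.2)
          (by simp only [List.length_append, List.length_cons]; grind) (by simp)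
        refine ⟨C, h1, h2, h3, fun x hx => ?_⟩
        have := h4 x hx
        simp only [List.mem_cons, List.mem_append] at this ⊢
        tauto
      · obtain ⟨C, h1, h2, h3, h4⟩ := ih (l₂.length + 1) (by omega)
          (a :: l₂) (by rw [Cycle.chain_coe_cons]; exact hl'.1)
          (by simpa using he) (by simp)
        refine ⟨C, h1, h2, h3, fun x hx => ?_⟩
        have := h4 x hx
        simp only [List.mem_cons, List.mem_append] at this ⊢
        tauto

/-- The vertex `u` is reached from `v` by a walk of the given length whose vertices after the first
one lie outside `T`. -/
inductive Walk (r : V → V → Prop) (T : Finset V) (v : V) : ℕ → V → Prop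
  | nil : Walk r T v 0 v
  | snoc {i : ℕ} {u w : V} : Walk r T v i u → r u w → w ∉ T → Walk r T v (i + 1) w

theorem Walk.exists_list {T : Finset V} {v u z : V} {i : ℕ} (h : Walk r T v i u) (hz : r u z) :
    ∃ l : List V, l.length = i ∧ List.IsChain r (v :: (l ++ [z])) ∧ ∀ x ∈ l, x ∉ T := by
  induction h generalizing z with
  | nil => exact ⟨[], rfl, by simpa using hz, by simp⟩
  | @snoc i u w hu hw hT ih =>
    obtain ⟨l, h1, h2, h3⟩ := ih hw
    refine ⟨l ++ [w], by simp [h1], ?_, ?_⟩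
    · have : v :: (l ++ [w] ++ [z]) = (v :: l) ++ w :: [z] := by simp
      rw [this, List.isChain_split]
      exact ⟨h2, by simpa using hz⟩
    · intro x hx
      simp only [List.mem_append, List.mem_singleton] at hx
      rcases hx with hx | rfl
      · exact h3 x hx
      · exact hT

end Walks

/-! ### Cuts of the parity network versus transversals. -/

section Cut

/-- The capacity of the arcs that leave `U`, in a network on the nodes `0, …, N - 1`. -/
def cut (N : ℕ) (R : ℕ → ℕ → ℕ) (U : Finset ℕ) : ℕ :=
  ∑ a ∈ range N, ∑ b ∈ range N, if a ∈ U ∧ b ∉ U then R a b else 0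

theorem cut_congr {N : ℕ} {R R' : ℕ → ℕ → ℕ} (h : ∀ a < N, ∀ b < N, R a b = R' a b)
    (U : Finset ℕ) : cut N R U = cut N R' U := by
  refine sum_congr rfl fun a ha => sum_congr rfl fun b hb => ?_
  rw [h a (mem_range.1 ha) b (mem_range.1 hb)]

/-- Send one unit along the arc from `p` to `c`. -/
def push (R : ℕ → ℕ → ℕ) (p c : ℕ) : ℕ → ℕ → ℕ := fun a b =>
  if a = p ∧ b = c then R a b - 1 else if a = c ∧ b = p then R a b + 1 else R a b

/-- The arc and its reverse are distinct entries, and each contributes to the cut only when it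
leaves `U`. The identity is free of subtraction, so along a path the contributions telescope to the
two ends. -/
theorem cut_push {N : ℕ} {R : ℕ → ℕ → ℕ} {p c : ℕ} (hp : p < N) (hc : c < N) (hpc : p ≠ c)
    (hR : 0 < R p c) (U : Finset ℕ) :
    cut N (push R p c) U + (if p ∈ U then 1 else 0) = cut N R U + if c ∈ U then 1 else 0 := by
  have single : ∀ x < N, ∀ y < N, ∑ a ∈ range N, ∑ b ∈ range N,
      (if a = x ∧ b = y then if x ∈ U ∧ y ∉ U then 1 else 0 else 0 : ℤ) =
        if x ∈ U ∧ y ∉ U then 1 else 0 := by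
    intro x hx y hy
    rw [sum_eq_single x, sum_eq_single y]
    · simp
    · intro b _ hb; simp [hb]
    · intro h; simp at h; omega
    · intro a _ ha; simp [ha]
    · intro h; simp at h; omega
  have key : (cut N (push R p c) U : ℤ) =
      cut N R U - (if p ∈ U ∧ c ∉ U then 1 else 0) + if c ∈ U ∧ p ∉ U then 1 else 0 := by
    rw [← single p hp c hc, ← single c hc p hp]
    simp only [cut, Nat.cast_sum, ← sum_sub_distrib, ← sum_add_distrib]
    refine sum_congr rfl fun a _ => sum_congr rfl fun b _ => ?_
    simp only [push]
    by_cases h1 : a = p ∧ b = c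
    · obtain ⟨rfl, rfl⟩ := h1
      have : ¬ (a = b ∧ b = a) := fun h => hpc h.1
      simp only [and_self, if_true, this, if_false, add_zero]
      split_ifs
      · push_cast [Nat.cast_sub hR]; ring
      · simp
    · by_cases h2 : a = c ∧ b = p
      · obtain ⟨rfl, rfl⟩ := h2
        simp only [and_self, if_true, h1, if_false]
        split_ifs <;> simp
      · simp [h1, h2]
  have : (cut N (push R p c) U + (if p ∈ U then 1 else 0) : ℤ) =
      cut N R U + if c ∈ U then 1 else 0 := by
    rw [key]
    by_cases h1 : p ∈ U <;> by_cases h2 : c ∈ U <;> simp [h1, h2]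
  exact_mod_cast this

open Classical in
/-- The capacities of the split bipartite double cover. Each vertex `u` has the four nodes
`4 * u + 2 * i` (entrance) and `4 * u + 2 * i + 1` (exit) for the parities `i = 0, 1`. -/
noncomputable def cap (A : ℕ → ℕ → Prop) (M v a b : ℕ) : ℕ :=
  if (a % 4 = 1 ∧ b % 4 = 2) ∨ (a % 4 = 3 ∧ b % 4 = 0) then
    if A (a / 4) (b / 4) then M else 0
  else if a % 2 = 0 ∧ b = a + 1 ∧ a / 4 ≠ v then 1 else 0

theorem le_cut {N : ℕ} {R : ℕ → ℕ → ℕ} {U : Finset ℕ} {a b : ℕ} (ha : a < N) (hb : b < N)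
    (haU : a ∈ U) (hbU : b ∉ U) : R a b ≤ cut N R U := by
  calc R a b = if a ∈ U ∧ b ∉ U then R a b else 0 := by simp [haU, hbU]
    _ ≤ ∑ b ∈ range N, if a ∈ U ∧ b ∉ U then R a b else 0 :=
      single_le_sum (f := fun b => if a ∈ U ∧ b ∉ U then R a b else 0) (fun _ _ => Nat.zero_le _)
        (mem_range.2 hb)
    _ ≤ cut N R U :=
      single_le_sum (f := fun a => ∑ b ∈ range N, if a ∈ U ∧ b ∉ U then R a b else 0)
        (fun _ _ => Nat.zero_le _) (mem_range.2 ha)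

variable {n : ℕ} (D : Digraph (Fin n))

/-- The arcs of `D`, as a relation on the natural numbers. -/
def natAdj (a b : ℕ) : Prop := ∃ (ha : a < n) (hb : b < n), D.Adj ⟨a, ha⟩ ⟨b, hb⟩

/-- A transversal that avoids `v` gives a cut of twice its size. -/
theorem exists_cut_of_transversal {T : Finset (Fin n)} (hT : D.IsOddCycleTransversal T)
    {v : Fin n} (hv : v ∉ T) (M : ℕ) :
    ∃ U : Finset ℕ, 4 * (v : ℕ) + 1 ∈ U ∧ 4 * (v : ℕ) + 2 ∉ U ∧
      cut (4 * n) (cap (natAdj D) M v) U ≤ 2 * T.card := by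
  classical
  -- `E` and `I` describe the exits and entrances reached from `v` without passing through `T`; for
  -- `i < 2` the other parity is `1 - i`.
  let E : ℕ → Fin n → Prop := fun i u => ∃ j, j % 2 = i ∧ Walk D.Adj T v j u
  let I : ℕ → Fin n → Prop := fun i w => ∃ u, E (1 - i) u ∧ D.Adj u w
  have hEI : ∀ i < 2, ∀ w, I i w → w ∉ T → E i w := by
    rintro i hi w ⟨u, ⟨j, hj, hW⟩, huw⟩ hw
    exact ⟨j + 1, by omega, hW.snoc huw hw⟩
  let inU : ℕ → Prop := fun a => ∃ u : Fin n, ∃ i < 2,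
    (a = 4 * (u : ℕ) + 2 * i + 1 ∧ E i u) ∨ (a = 4 * (u : ℕ) + 2 * i ∧ I i u)
  have hmemE : ∀ (u : Fin n), ∀ i < 2, inU (4 * (u : ℕ) + 2 * i + 1) ↔ E i u := by
    intro u i hi
    constructor
    · rintro ⟨u', i', hi', ⟨h, hE⟩ | ⟨h, hI⟩⟩
      · obtain rfl : u = u' := Fin.ext (by omega)
        obtain rfl : i = i' := by omega
        exact hE
      · omega
    · exact fun h => ⟨u, i, hi, Or.inl ⟨rfl, h⟩⟩
  have hmemI : ∀ (u : Fin n), ∀ i < 2, inU (4 * (u : ℕ) + 2 * i) ↔ I i u := by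
    intro u i hi
    constructor
    · rintro ⟨u', i', hi', ⟨h, hE⟩ | ⟨h, hI⟩⟩
      · omega
      · obtain rfl : u = u' := Fin.ext (by omega)
        obtain rfl : i = i' := by omega
        exact hI
    · exact fun h => ⟨u, i, hi, Or.inr ⟨rfl, h⟩⟩
  have hUlt : ∀ a, inU a → a < 4 * n := by
    rintro a ⟨u, i, hi, h⟩
    have := u.2
    omega
  refine ⟨(range (4 * n)).filter inU, ?_, ?_, ?_⟩
  · have h := (hmemE v 0 (by norm_num)).2 ⟨0, rfl, Walk.nil⟩
    exact mem_filter.2 ⟨mem_range.2 (hUlt _ h), h⟩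
  · rw [mem_filter, not_and]
    intro _ h
    -- Reaching the odd entrance of `v` would close an odd walk outside `T`, which contains an odd
    -- cycle missing `T`.
    obtain ⟨u, ⟨j, hj, hW⟩, huv⟩ := (hmemI v 1 (by norm_num)).1 h
    obtain ⟨l, hl1, hl2, hl3⟩ := hW.exists_list huv
    obtain ⟨C, h1, h2, h3, h4⟩ := exists_odd_cycle_of_odd_closed_walk (r := D.Adj) (v :: l)
      (by rw [Cycle.chain_coe_cons]; exact hl2) (by
        rw [List.length_cons, hl1]; exact Nat.odd_iff.2 (by omega))
    obtain ⟨x, hxC, hxT⟩ := hT C ⟨h1, h2⟩ h3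
    rcases List.mem_cons.1 (h4 x hxC) with rfl | hx
    · exact hv hxT
    · exact hl3 x hx hxT
  -- The reached set is closed under arcs of the digraph, so only the entrance-exit arcs of vertices
  -- of `T` can leave it, two for each vertex.
  · have hcross : ∀ a < 4 * n, ∀ b < 4 * n, a ∈ (range (4 * n)).filter inU →
        b ∉ (range (4 * n)).filter inU → cap (natAdj D) M v a b ≠ 0 →
        b = a + 1 ∧ (cap (natAdj D) M v a b = 1) ∧ a % 2 = 0 ∧ ∃ h : a / 4 < n, ⟨a / 4, h⟩ ∈ T := by
      intro a ha b hb haU hbU hcap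
      have haU := (mem_filter.1 haU).2
      have hbU : ¬ inU b := fun h => hbU (mem_filter.2 ⟨mem_range.2 hb, h⟩)
      rw [cap] at hcap ⊢
      split_ifs at hcap ⊢ with h1 h2 h2
      · exfalso
        obtain ⟨h3, h4, h5⟩ := h2
        obtain ⟨i, hi, hai, hbi⟩ : ∃ i < 2, a = 4 * (a / 4) + 2 * i + 1 ∧
            b = 4 * (b / 4) + 2 * (1 - i) := by
          rcases h1 with h1 | h1
          · exact ⟨0, by omega⟩
          · exact ⟨1, by omega⟩
        rw [hai] at haU
        rw [hbi] at hbU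
        refine hbU ((hmemI ⟨b / 4, h4⟩ (1 - i) (by omega)).2
          ⟨⟨a / 4, h3⟩, ?_, h5⟩)
        rw [show 1 - (1 - i) = i by omega]
        exact (hmemE ⟨a / 4, h3⟩ i hi).1 haU
      · exact absurd rfl hcap
      · refine ⟨h2.2.1, rfl, h2.1, by omega, ?_⟩
        by_contra hnT
        obtain ⟨i, hi, hai⟩ : ∃ i < 2, a = 4 * (a / 4) + 2 * i := ⟨a % 4 / 2, by omega, by omega⟩
        have hlt : a / 4 < n := by omega
        have hbi : b = 4 * (a / 4) + 2 * i + 1 := by omega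
        rw [hai] at haU
        rw [hbi] at hbU
        exact hbU ((hmemE ⟨a / 4, hlt⟩ i hi).2
          (hEI i hi _ ((hmemI ⟨a / 4, hlt⟩ i hi).1 haU) hnT))
      · exact absurd rfl hcap
    set U := (range (4 * n)).filter inU with hU
    let S := (range (4 * n)).filter fun a => a % 2 = 0 ∧ ∃ h : a / 4 < n, (⟨a / 4, h⟩ : Fin n) ∈ T
    have hrow : ∀ a ∈ range (4 * n), (∑ b ∈ range (4 * n),
        if a ∈ U ∧ b ∉ U then cap (natAdj D) M v a b else 0) ≤
          if a % 2 = 0 ∧ ∃ h : a / 4 < n, (⟨a / 4, h⟩ : Fin n) ∈ T then 1 else 0 := by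
      intro a ha
      have hz : ∀ b ∈ range (4 * n), b ≠ a + 1 →
          (if a ∈ U ∧ b ∉ U then cap (natAdj D) M v a b else 0) = 0 := by
        intro b hb hne
        by_contra h
        split_ifs at h with h1
        · exact hne (hcross a (mem_range.1 ha) b (mem_range.1 hb) h1.1 h1.2 h).1
        · exact h rfl
      by_cases hlt : a + 1 < 4 * n
      · rw [sum_eq_single (a + 1) hz (fun h => absurd (mem_range.2 hlt) h)]
        by_cases hc : (if a ∈ U ∧ a + 1 ∉ U then cap (natAdj D) M v a (a + 1) else 0) = 0
        · rw [hc]; exact Nat.zero_le _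
        · split_ifs at hc with h1
          · have := hcross a (mem_range.1 ha) (a + 1) hlt h1.1 h1.2 hc
            rw [if_pos h1, if_pos this.2.2, this.2.1]
          · exact absurd rfl hc
      · rw [sum_eq_zero fun b hb => hz b hb (by have := mem_range.1 hb; omega)]
        exact Nat.zero_le _
    have hcard : S.card ≤ (T ×ˢ range 2).card := by
      refine card_le_card_of_surjOn (fun p => 4 * (p.1 : ℕ) + 2 * p.2) fun a ha => ?_
      obtain ⟨-, h1, h2, h3⟩ := mem_filter.1 (mem_coe.1 ha)
      exact ⟨(⟨a / 4, h2⟩, a % 4 / 2), by simp [h3]; omega, by simp; omega⟩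
    calc cut (4 * n) (cap (natAdj D) M v) U
        ≤ ∑ a ∈ range (4 * n),
          if a % 2 = 0 ∧ ∃ h : a / 4 < n, (⟨a / 4, h⟩ : Fin n) ∈ T then 1 else 0 := sum_le_sum hrow
      _ = S.card := by simp [S]
      _ ≤ _ := hcard
      _ = 2 * T.card := by simp [mul_comm]

/-- A small cut gives a set of at most the same size that avoids `v` and meets each closed walk of
odd length that visits `v` once. -/
theorem exists_hitting_of_cut {v : Fin n} {M : ℕ} {U : Finset ℕ} (hs : 4 * (v : ℕ) + 1 ∈ U)
    (ht : 4 * (v : ℕ) + 2 ∉ U) (hM : cut (4 * n) (cap (natAdj D) M v) U < M) :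
    ∃ X : Finset (Fin n), v ∉ X ∧ X.card ≤ cut (4 * n) (cap (natAdj D) M v) U ∧
      ∀ l : List (Fin n), v ∉ l → List.IsChain D.Adj (v :: (l ++ [v])) → Even l.length →
        ∃ x ∈ l, x ∈ X := by
  classical
  let X : Finset (Fin n) := univ.filter fun u => u ≠ v ∧ ∃ i < 2,
    4 * (u : ℕ) + 2 * i ∈ U ∧ 4 * (u : ℕ) + 2 * i + 1 ∉ U
  refine ⟨X, by simp [X], ?_, ?_⟩
  · let S := (range (4 * n) ×ˢ range (4 * n)).filter fun p => (p.1 ∈ U ∧ p.2 ∉ U) ∧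
      1 ≤ cap (natAdj D) M v p.1 p.2
    calc X.card ≤ S.card := by
          refine card_le_card_of_surjOn (fun p => if h : p.1 / 4 < n then ⟨p.1 / 4, h⟩ else v)
            fun u hu => ?_
          obtain ⟨-, huv, i, hi, h1, h2⟩ := mem_filter.1 (mem_coe.1 hu)
          have hu := u.2
          refine ⟨(4 * (u : ℕ) + 2 * i, 4 * (u : ℕ) + 2 * i + 1), ?_, ?_⟩
          · rw [mem_coe, mem_filter, mem_product, mem_range, mem_range]
            refine ⟨⟨by dsimp; omega, by dsimp; omega⟩, ⟨h1, h2⟩, ?_⟩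
            have huv' : (u : ℕ) ≠ v := fun h => huv (Fin.ext h)
            simp only [cap]
            rw [if_neg (by omega), if_pos ⟨by omega, trivial, by omega⟩]
          · have : (4 * (u : ℕ) + 2 * i) / 4 = u := by omega
            simp [this]
      _ = ∑ p ∈ S, 1 := by simp
      _ ≤ ∑ p ∈ S, if p.1 ∈ U ∧ p.2 ∉ U then cap (natAdj D) M v p.1 p.2 else 0 := by
          refine sum_le_sum fun p hp => ?_
          obtain ⟨-, h1, h2⟩ := mem_filter.1 hp
          rw [if_pos h1]; exact h2
      _ ≤ ∑ p ∈ range (4 * n) ×ˢ range (4 * n),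
            if p.1 ∈ U ∧ p.2 ∉ U then cap (natAdj D) M v p.1 p.2 else 0 :=
          sum_le_sum_of_subset (filter_subset _ _)
      _ = cut (4 * n) (cap (natAdj D) M v) U := by rw [cut, sum_product]
  -- An arc of the digraph has capacity `M`, more than the whole cut, so it cannot leave `U`.
  · have arc : ∀ u w : Fin n, D.Adj u w → ∀ i < 2, 4 * (u : ℕ) + 2 * i + 1 ∈ U →
        4 * (w : ℕ) + 2 * (1 - i) ∈ U := by
      intro u w huw i hi hu
      by_contra hw
      have h1 := u.2
      have h2 := w.2
      have h := le_cut (R := cap (natAdj D) M v) (N := 4 * n) (by omega) (by omega) hu hw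
      have hc : cap (natAdj D) M v (4 * (u : ℕ) + 2 * i + 1) (4 * (w : ℕ) + 2 * (1 - i)) = M := by
        rw [cap, if_pos (by omega), if_pos]
        rw [show (4 * (u : ℕ) + 2 * i + 1) / 4 = u by omega,
          show (4 * (w : ℕ) + 2 * (1 - i)) / 4 = w by omega]
        exact ⟨h1, h2, huw⟩
      omega
    -- A walk whose inner vertices avoid `X` never leaves `U`, and the parity of its length
    -- determines which entrance of `v` it reaches.
    have walk : ∀ (l : List (Fin n)) (u : Fin n), ∀ i < 2, 4 * (u : ℕ) + 2 * i + 1 ∈ U →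
        List.IsChain D.Adj (u :: (l ++ [v])) → v ∉ l → (∀ x ∈ l, x ∉ X) →
        4 * (v : ℕ) + 2 * ((i + l.length + 1) % 2) ∈ U := by
      intro l
      induction l with
      | nil =>
        intro u i hi hu hc _ _
        have := arc u v (by simpa using hc) i hi hu
        convert this using 3
        simp; omega
      | cons w l ih =>
        intro u i hi hu hc hv hX
        simp only [List.cons_append, List.isChain_cons_cons] at hc
        have h1 := arc u w hc.1 i hi hu
        have h2 : 4 * (w : ℕ) + 2 * (1 - i) + 1 ∈ U := by
          by_contra h
          refine hX w (by simp) (mem_filter.2 ⟨mem_univ _, ?_, 1 - i, by omega, h1, h⟩)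
          rintro rfl
          simp at hv
        have := ih w (1 - i) (by omega) h2 hc.2 (fun h => hv (by simp [h]))
          fun x hx => hX x (by simp [hx])
        convert this using 3
        simp; omega
    intro l hv hc he
    by_contra h
    push Not at h
    have := walk l v 0 (by norm_num) hs hc hv h
    rw [zero_add, Nat.odd_iff.1 he.add_one] at this
    exact ht this

/-- `f` is the minimum capacity of a cut that separates `v` from its copy in the split double cover,
or this minimum is too large to matter. -/
structure IsCutValue (v : Fin n) (f : ℕ) : Prop where
  le_cut : ∀ U : Finset ℕ, 4 * (v : ℕ) + 1 ∈ U → 4 * (v : ℕ) + 2 ∉ U →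
    f ≤ cut (4 * n) (cap (natAdj D) (2 * n + 1) v) U
  exists_cut : f = 2 * n + 1 ∨ ∃ U : Finset ℕ, 4 * (v : ℕ) + 1 ∈ U ∧ 4 * (v : ℕ) + 2 ∉ U ∧
    cut (4 * n) (cap (natAdj D) (2 * n + 1) v) U = f

theorem isOddCycleTransversal_univ : D.IsOddCycleTransversal univ := by
  intro C _ ho
  induction C using Cycle.induction_on with
  | nil => simp at ho
  | cons a l _ => exact ⟨a, by simp, mem_univ a⟩

/-- The full vertex set is feasible, so the infimum in `optSize` is attained and is not the default
value 0 of an empty set. -/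
theorem exists_isOptimalSolution : ∃ T, IsOptimalSolution D.IsOddCycleTransversal T :=
  Nat.sInf_mem (s := {m : ℕ | ∃ S : Finset (Fin n), D.IsOddCycleTransversal S ∧ S.card = m})
    ⟨_, univ, isOddCycleTransversal_univ D, rfl⟩

/-- The vertices with large cut values are a correct output of 3-Essential Detection. -/
theorem isEssentialDetectionOutput_of_isCutValue {f : Fin n → ℕ}
    (hf : ∀ v, IsCutValue D v (f v)) (k : ℤ) {S : Finset (Fin n)}
    (hS : ∀ v, v ∈ S ↔ 2 * k.toNat < f v) :
    IsEssentialDetectionOutput (3 : ℝ) D.IsOddCycleTransversal k S := by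
  classical
  obtain ⟨T, hT⟩ := exists_isOptimalSolution D
  constructor
  -- Neither clause has content for negative `k`, so the use of `k.toNat` is harmless.
  · intro hk
    refine ⟨T, hT, fun v hv => ?_⟩
    by_contra hvT
    obtain ⟨U, h1, h2, h3⟩ := exists_cut_of_transversal D hT.1 hvT (2 * n + 1)
    have h4 := (hf v).le_cut U h1 h2
    have h5 := (hS v).1 hv
    have h6 := hT.2
    omega
  · intro hk v hess
    by_contra hvS
    rw [hS, not_lt] at hvS
    have hTn : T.card ≤ n := by simpa using card_le_univ T
    have hTk := hT.2
    by_cases hvT : v ∈ T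
    · rcases (hf v).exists_cut with h | ⟨U, h1, h2, h3⟩
      -- The capped value is excluded: here `f v ≤ 2 * k = 2 * T.card ≤ 2 * n`.
      · omega
      obtain ⟨X, hvX, hX, hit⟩ := exists_hitting_of_cut D (M := 2 * n + 1) h1 h2 (by omega)
      have hcard : (T.erase v ∪ X).card ≤ 3 * optSize D.IsOddCycleTransversal := by
        have := card_union_le (T.erase v) X
        have := card_erase_le (s := T) (a := v)
        omega
      have := hess (T.erase v ∪ X) ?_ (by exact_mod_cast hcard)
      · simp [hvX] at this
      intro C hC ho
      by_contra hno
      push Not at hno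
      obtain ⟨x, hxC, hxT⟩ := hT.1 C hC ho
      -- A cycle missed by the new set meets `T` in `v` alone; rotated to start at `v`, it must meet
      -- `X`.
      obtain rfl : x = v := by
        by_contra hne
        exact hno x hxC (by simp [hne, hxT])
      obtain ⟨l, rfl⟩ : ∃ l : List (Fin n), C = ((x :: l : List (Fin n)) : Cycle (Fin n)) := by
        induction C using Quotient.inductionOn' with
        | _ l₀ =>
          obtain ⟨l₁, l₂, rfl⟩ := List.append_of_mem (Cycle.mem_coe_iff.1 hxC)
          refine ⟨l₂ ++ l₁, ?_⟩
          rw [Cycle.mk''_eq_coe, Cycle.coe_eq_coe]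
          exact List.isRotated_append
      obtain ⟨hnd, hch⟩ := hC
      rw [Cycle.nodup_coe_iff, List.nodup_cons] at hnd
      rw [Cycle.chain_coe_cons] at hch
      obtain ⟨y, hyl, hyX⟩ := hit l hnd.1 hch (by
        rw [Cycle.length_coe, List.length_cons, Nat.odd_iff] at ho
        exact Nat.even_iff.2 (by omega))
      exact hno y (by simp [hyl]) (by simp [hyX])
    · exact hvT (hess T hT.1 (by
        rw [hT.2]
        have : (0 : ℝ) ≤ optSize D.IsOddCycleTransversal := Nat.cast_nonneg _
        linarith))

end Cut

end DOCT

/-! ### The detection program -/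

namespace LoopLang

/-- The sequential composition of a list of commands. -/
def Cmd.block : List Cmd → Cmd
  | [] => .skip
  | c :: l => .seq c (Cmd.block l)

@[simp] theorem Cmd.eval_block_nil (σ : State) : (Cmd.block []).eval σ = σ := rfl

@[simp] theorem Cmd.eval_block_cons (c : Cmd) (l : List Cmd) (σ : State) :
    (Cmd.block (c :: l)).eval σ = (Cmd.block l).eval (c.eval σ) := rfl

@[simp] theorem Cmd.eval_skip (σ : State) : Cmd.skip.eval σ = σ := rfl

@[simp] theorem Cmd.eval_assign (x : ℕ) (e : Expr) (σ : State) :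
    (Cmd.assign x e).eval σ = σ.set x (e.eval σ) := rfl

@[simp] theorem Cmd.eval_store (e f : Expr) (σ : State) :
    (Cmd.store e f).eval σ = σ.put (e.eval σ) (f.eval σ) := rfl

@[simp] theorem Cmd.eval_ite (e : Expr) (c d : Cmd) (σ : State) :
    (Cmd.ite e c d).eval σ = if 0 < e.eval σ then c.eval σ else d.eval σ := rfl

/-- Compute the address `base + w * i + j` in variable `8`. -/
def address (base : Expr) (w : ℕ) (i j : Expr) : Cmd := .block
  [.assign 5 i, .assign 6 j, .assign 8 base,
    .loop 7 w (.assign 8 (.add (.var 8) (.var 5))), .assign 8 (.add (.var 8) (.var 6))]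

/-- With addition as the only growing operation, the product is a repeated sum. -/
theorem eval_loop_add (w : ℕ) (σ : State) :
    (Cmd.loop 7 w (.assign 8 (.add (.var 8) (.var 5)))).eval σ =
      (σ.set 7 (σ.v w)).set 8 (σ.v 8 + σ.v w * σ.v 5) := by
  rw [Cmd.eval]
  generalize σ.v w = k
  induction k with
  | zero => ext y <;> simp; intro h; simp [h]
  | succ k ih =>
    rw [Function.iterate_succ_apply', ih]
    ext y
    · simp only [Cmd.eval_assign, Expr.eval, State.set_v]
      by_cases h : y = 7 <;> by_cases h8 : y = 8 <;> simp [h, h8]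
      ring
    · simp

-- The shifted states appear because `j` is evaluated after variable 5 is overwritten, and `base`
-- after 5 and 6.
@[simp] theorem eval_address (base : Expr) {w : ℕ} (i j : Expr) (σ : State) (h5 : w ≠ 5 := by decide)
    (h6 : w ≠ 6 := by decide)
    (h8 : w ≠ 8 := by decide) :
    (address base w i j).eval σ = (((σ.set 5 (i.eval σ)).set 6 (j.eval (σ.set 5 (i.eval σ)))).set 7
      (σ.v w)).set 8 (base.eval ((σ.set 5 (i.eval σ)).set 6 (j.eval (σ.set 5 (i.eval σ)))) +
        σ.v w * i.eval σ + j.eval (σ.set 5 (i.eval σ))) := by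
  simp only [address, Cmd.eval_block_cons, Cmd.eval_block_nil, Cmd.eval_assign, eval_loop_add]
  ext y
  · simp only [Expr.eval, State.set_v]
    by_cases h7 : y = 7 <;> by_cases h8 : y = 8 <;> simp [*]
  · simp

/-- Read the entry with index `(i, j)` of the matrix of width `var 1` at address `var 2`. -/
def readEntry (x : ℕ) (i j : Expr) : Cmd :=
  .block [address (.var 2) 1 i j, .assign x (.get (.var 8))]

/-- Write the entry with index `(i, j)` of the matrix of width `var 1` at address `var 2`. -/
def writeEntry (i j e : Expr) : Cmd :=
  .block [address (.var 2) 1 i j, .store (.var 8) e]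

/-- The row of the matrix that holds the depths of the nodes in the search tree. -/
def depthRow : Expr := .var 1

/-- The row that holds the predecessors of the nodes in the search tree. -/
def predRow : Expr := .add (.var 1) (.lit 1)

/-- The row that holds the output. -/
def outRow : Expr := .add (.var 1) (.lit 2)

/-- An expression that is positive if and only if the two values agree. -/
def eqExpr (e f : Expr) : Expr := .sub (.lit 1) (.add (.sub e f) (.sub f e))

/-- An expression that is positive if and only if both values are positive. -/
def andExpr (e f : Expr) : Expr :=
  .sub (.lit 1) (.add (.sub (.lit 1) e) (.sub (.lit 1) f))

/-- Set `x` to `y / 4`, provided that this is at most the value of variable `0`. -/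
def quarter (x : ℕ) (y : ℕ) : Cmd := .block [.assign x (.lit 0),
  -- In round `i` the test is `4 * (i + 1) ≤ y`, which succeeds `y / 4` times if there are enough
  -- rounds.
  .loop 7 0 (.ite (.sub (.var y) (.add (.lit 3)
    (.add (.add (.var 7) (.var 7)) (.add (.var 7) (.var 7)))))
    (.assign x (.add (.var x) (.lit 1))) .skip)]

/-- The difference of variable `y` and four times variable `x`. -/
def remainder (y x : ℕ) : Expr :=
  .sub (.var y) (.add (.add (.var x) (.var x)) (.add (.var x) (.var x)))

/-- Compute in variable `19` the capacity of the arc from node `var 10` to node `var 11`. -/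
def capacity : Cmd := .block [quarter 23 11, .assign 19 (.lit 0),
  .assign 20 (remainder 10 22), .assign 21 (remainder 11 23),
  .ite (.add (andExpr (eqExpr (.var 20) (.lit 1)) (eqExpr (.var 21) (.lit 2)))
      (andExpr (eqExpr (.var 20) (.lit 3)) (eqExpr (.var 21) (.lit 0))))
    (.block [address (.lit 3) 0 (.var 22) (.var 23),
      .ite (.get (.var 8)) (.assign 19 (.var 4)) .skip])
    (.ite (.add (eqExpr (.var 20) (.lit 0)) (eqExpr (.var 20) (.lit 2)))
      (.ite (eqExpr (.var 11) (.add (.var 10) (.lit 1)))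
        (.ite (.add (.sub (.var 22) (.var 9)) (.sub (.var 9) (.var 22)))
          (.assign 19 (.lit 1)) .skip) .skip) .skip)]

/-- Initialize the residual capacities. -/
def fill : Cmd := .loop 10 1 (.block [quarter 22 10,
  .loop 11 1 (.block [capacity, writeEntry (.var 10) (.var 11) (.var 19)])])

/-- Extend the search tree along one arc. -/
def relax : Cmd := .block [readEntry 19 depthRow (.var 10), readEntry 20 depthRow (.var 11),
  readEntry 21 (.var 10) (.var 11),
  .ite (.var 19) (.ite (.var 20) .skip (.ite (.var 21)
    (.block [writeEntry depthRow (.var 11) (.add (.var 19) (.lit 1)),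
      writeEntry predRow (.var 11) (.var 10)]) .skip)) .skip]

/-- Extend the search tree along all arcs. -/
def relaxAll : Cmd := .loop 10 1 (.loop 11 1 relax)

/-- Search for the nodes that can be reached from node `var 17`. -/
def search : Cmd := .block [
  .loop 11 1 (writeEntry depthRow (.var 11) (.lit 0)),
  writeEntry depthRow (.var 17) (.lit 1),
  .loop 12 1 relaxAll]

/-- One step back along the path in the search tree. -/
def stepBack : Cmd := .block [readEntry 19 depthRow (.var 15),
  -- The root has depth 1; once it is reached, the remaining rounds do nothing.
  .ite (.sub (.var 19) (.lit 1))
    (.block [readEntry 16 predRow (.var 15),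
      readEntry 20 (.var 16) (.var 15),
      writeEntry (.var 16) (.var 15) (.sub (.var 20) (.lit 1)),
      readEntry 21 (.var 15) (.var 16),
      writeEntry (.var 15) (.var 16) (.add (.var 21) (.lit 1)),
      .assign 15 (.var 16)]) .skip]

/-- Send one unit of flow to node `var 18`. -/
def augment : Cmd := .block [.assign 15 (.var 18), .loop 24 1 stepBack]

/-- Search for an augmenting path, and use it. -/
def improve : Cmd := .block [search, readEntry 19 depthRow (.var 18),
  .ite (.var 19) (.block [augment, .assign 14 (.add (.var 14) (.lit 1))]) .skip]

/-- Compute the cut value of vertex `var 9` in variable `14`. -/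
def cutValue : Cmd := .block [
  -- The source is the even exit of `v`, the sink its odd entrance.
  .assign 17 (.add (.add (.add (.var 9) (.var 9)) (.add (.var 9) (.var 9))) (.lit 1)),
  .assign 18 (.add (.var 17) (.lit 1)),
  fill, .assign 14 (.lit 0), .loop 13 4 improve]

/-- Compute the output in the last row of the matrix. -/
def decideAll : Cmd := .loop 9 0 (.block [cutValue,
  -- Nonzero exactly when the cut value exceeds the threshold. The result is parked behind the
  -- matrix, because the low cells still hold the input needed for later vertices.
  writeEntry outRow (.var 9) (.sub (.var 14) (.var 3))])

/-- Copy the output to the start of the memory. -/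
def copyOut : Cmd := .loop 9 0 (.block [readEntry 19 outRow (.var 9), .store (.var 9) (.var 19)])

/-- Read the input. -/
def setSizes : Cmd := .block [.assign 0 (.get (.lit 0)),
  -- Variable 0 is n, 1 the number 4n of nodes, 3 the threshold 2k, 4 the cap 2n + 1 and also the
  -- number of flow rounds.
  .assign 1 (.add (.add (.var 0) (.var 0)) (.add (.var 0) (.var 0))),
  .assign 3 (.add (.get (.lit 1)) (.get (.lit 1))),
  .assign 4 (.add (.add (.var 0) (.var 0)) (.lit 1))]

/-- The part of the program after the sizes are known. -/
def mainPart : Cmd := .block [address (.lit 3) 0 (.var 0) (.lit 0), .assign 2 (.var 8), decideAll,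
  copyOut]

/-- The program for 3-Essential Detection for Directed Odd Cycle Transversal. -/
def detect : Cmd := .seq setSizes mainPart

/-- The loop bounds are assigned in the loop-free `setSizes`; splitting it off leaves a program that
never writes them. -/
theorem bounds_mainPart : ∀ y ∈ mainPart.bounds, y ∉ mainPart.writes ∧ (y = 0 ∨ y = 1 ∨ y = 4) := by
  decide

end LoopLang

/-! ### Correctness of the detection program -/

namespace LoopLang

open Finset

/-! ### Address arithmetic and the table of capacities. -/

theorem index_inj {s N a b c d : ℕ} (hb : b < N) (hd : d < N) :
    s + N * a + b = s + N * c + d ↔ a = c ∧ b = d := by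
  constructor
  · intro h
    have h' : N * a + b = N * c + d := by omega
    have h1 : a = c := by
      have := congrArg (· / N) h'
      simpa [Nat.mul_add_div (by omega : N > 0), Nat.div_eq_of_lt hb, Nat.div_eq_of_lt hd] using this
    subst h1
    exact ⟨rfl, by omega⟩
  · rintro ⟨rfl, rfl⟩; rfl

theorem index_lt {s N a b c : ℕ} (hb : b < N) (ha : a < c) : s + N * a + b < s + N * c := by
  have : N * (a + 1) ≤ N * c := Nat.mul_le_mul_left N ha
  rw [mul_add] at this
  omega

theorem le_index {s N a b c : ℕ} (hc : c ≤ a) : s + N * c ≤ s + N * a + b := by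
  have : N * c ≤ N * a := Nat.mul_le_mul_left N hc
  omega

theorem quarter_spec (x y : ℕ) (hx : x ≠ 7) (hy : y ≠ 7) (hxy : x ≠ y) (hx0 : x ≠ 0) (σ : State)
    (h : σ.v y < 4 * σ.v 0) :
    ((quarter x y).eval σ).v x = σ.v y / 4 ∧ ((quarter x y).eval σ).m = σ.m := by
  have key := Cmd.eval_loop_induction (x := 7) (y := 0) (c := (.ite (.sub (.var y) (.add (.lit 3)
    (.add (.add (.var 7) (.var 7)) (.add (.var 7) (.var 7)))))
    (.assign x (.add (.var x) (.lit 1))) .skip)) (σ := σ.set x 0)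
    (fun i τ => τ.v x = min i (σ.v y / 4) ∧ τ.v y = σ.v y ∧ τ.m = σ.m)
    (by simp [Cmd.writes, hx.symm]) (by simp [hx, hy, hxy.symm]) (by
      rintro i hi τ h7 - ⟨h1, h2, h3⟩
      simp only [Cmd.eval_ite, Expr.eval, h7, h2, Cmd.eval_assign, Cmd.eval_skip]
      split_ifs with h4
      · simp [hx, hy, hxy.symm, h2, h3, h1]; omega
      · simp [hx, hy, h2, h3, h1]; omega)
  simp only [State.set_v, if_neg hx0.symm] at key
  simp only [quarter, Cmd.eval_block_cons, Cmd.eval_block_nil, Cmd.eval_assign, Expr.eval]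
  exact ⟨by rw [key.1]; omega, key.2.2⟩

theorem eqExpr_pos (e f : Expr) (σ : State) : 0 < (eqExpr e f).eval σ ↔ e.eval σ = f.eval σ := by
  simp [eqExpr]; omega

theorem andExpr_pos (e f : Expr) (σ : State) :
    0 < (andExpr e f).eval σ ↔ 0 < e.eval σ ∧ 0 < f.eval σ := by
  simp [andExpr]; omega

theorem addExpr_pos (e f : Expr) (σ : State) :
    0 < (Expr.add e f).eval σ ↔ 0 < e.eval σ ∨ 0 < f.eval σ := by
  simp

theorem capacity_spec (A : ℕ → ℕ → Prop) {n : ℕ} (τ : State) (h0 : τ.v 0 = n)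
    (h22 : τ.v 22 = τ.v 10 / 4) (h10 : τ.v 10 < 4 * n) (h11 : τ.v 11 < 4 * n)
    (hA : ∀ u < n, ∀ w < n, 0 < τ.m (3 + n * u + w) ↔ A u w) :
    (capacity.eval τ).v 19 = DOCT.cap A (τ.v 4) (τ.v 9) (τ.v 10) (τ.v 11) ∧
      (capacity.eval τ).m = τ.m := by
  obtain ⟨hq1, hq2⟩ := quarter_spec 23 11 (by decide) (by decide) (by decide) (by decide) τ
    (by rw [h0]; exact h11)
  have hq3 : ∀ z, z ≠ 23 → z ≠ 7 → ((quarter 23 11).eval τ).v z = τ.v z := fun z h1 h2 =>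
    Cmd.eval_v_of_notMem _ _ (by simp [quarter, Cmd.block, Cmd.writes, h1, h2])
  rw [capacity, Cmd.eval_block_cons]
  generalize (quarter 23 11).eval τ = ρ at *
  have e0 := hq3 0 (by decide) (by decide)
  have e4 := hq3 4 (by decide) (by decide)
  have e9 := hq3 9 (by decide) (by decide)
  have e10 := hq3 10 (by decide) (by decide)
  have e11 := hq3 11 (by decide) (by decide)
  have e22 := hq3 22 (by decide) (by decide)
  have hA' := hA (τ.v 10 / 4) (by omega) (τ.v 11 / 4) (by omega)
  simp only [Cmd.eval_block_cons, Cmd.eval_block_nil, Cmd.eval_assign, Cmd.eval_ite, addExpr_pos,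
    andExpr_pos, eqExpr_pos, Cmd.eval_skip, DOCT.cap]
  have hr : ∀ a : ℕ, a - (a / 4 + a / 4 + (a / 4 + a / 4)) = a % 4 := fun a => by omega
  by_cases hu : A (τ.v 10 / 4) (τ.v 11 / 4) <;> have hm := hA' <;>
    simp only [hu, iff_true, iff_false] at hm <;>
    simp [e0, e4, e9, e10, e11, e22, hq1, hq2, h22, h0, remainder, hr, hu, hm] <;>
    constructor <;> split_ifs <;> first | omega | simp [hq2]

/-- The entry with index `(a, b)` of the matrix of width `N` at address `B`. -/
def entry (m : ℕ → ℕ) (B N a b : ℕ) : ℕ := m (B + N * a + b)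

/-- Memory layout: three header cells, the adjacency matrix from address 3, then from `3 + n * n` a
matrix of width `4 * n` whose first `4 * n` rows are residual capacities, followed by the rows of
depths, predecessors and outputs. -/
theorem fill_spec (A : ℕ → ℕ → Prop) {n : ℕ} (σ : State) (h0 : σ.v 0 = n) (h1 : σ.v 1 = 4 * n)
    (h2 : σ.v 2 = 3 + n * n) (hA : ∀ u < n, ∀ w < n, 0 < σ.m (3 + n * u + w) ↔ A u w) :
    (∀ a < 4 * n, ∀ b < 4 * n, entry (fill.eval σ).m (3 + n * n) (4 * n) a b =
      DOCT.cap A (σ.v 4) (σ.v 9) a b) ∧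
    ∀ i, (i < 3 + n * n ∨ 3 + n * n + 4 * n * (4 * n) ≤ i) → (fill.eval σ).m i = σ.m i := by
  have key := Cmd.eval_loop_induction (x := 10) (y := 1) (σ := σ) (c := .block [quarter 22 10,
    .loop 11 1 (.block [capacity, writeEntry (.var 10) (.var 11) (.var 19)])])
    (fun i τ => (∀ a < i, ∀ b < 4 * n, entry τ.m (3 + n * n) (4 * n) a b =
      DOCT.cap A (σ.v 4) (σ.v 9) a b) ∧
    ∀ i, (i < 3 + n * n ∨ 3 + n * n + 4 * n * (4 * n) ≤ i) → τ.m i = σ.m i) (by decide)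
    (by simp) ?_
  · rw [h1] at key
    exact key
  intro i hi τ hx hfr ⟨hI, hm⟩
  rw [h1] at hi
  obtain ⟨hq1, hq2⟩ := quarter_spec 22 10 (by decide) (by decide) (by decide) (by decide) τ
    (by rw [hx, hfr 0 (by decide), h0]; exact hi)
  have hq3 := fun z (hz : z ∉ (quarter 22 10).writes) => Cmd.eval_v_of_notMem _ τ hz
  simp only [Cmd.eval_block_cons, Cmd.eval_block_nil]
  generalize (quarter 22 10).eval τ = ρ at *
  have e0 := (hq3 0 (by decide)).trans (hfr 0 (by decide))
  have e1 := (hq3 1 (by decide)).trans (hfr 1 (by decide))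
  have e2 := (hq3 2 (by decide)).trans (hfr 2 (by decide))
  have e4 := (hq3 4 (by decide)).trans (hfr 4 (by decide))
  have e9 := (hq3 9 (by decide)).trans (hfr 9 (by decide))
  have e10 := (hq3 10 (by decide)).trans hx
  have key := Cmd.eval_loop_induction (x := 11) (y := 1) (σ := ρ)
    (c := .block [capacity, writeEntry (.var 10) (.var 11) (.var 19)])
    (fun j τ => (∀ a b, b < 4 * n → (a < i ∨ a = i ∧ b < j) →
      entry τ.m (3 + n * n) (4 * n) a b = DOCT.cap A (σ.v 4) (σ.v 9) a b) ∧
    ∀ i, (i < 3 + n * n ∨ 3 + n * n + 4 * n * (4 * n) ≤ i) → τ.m i = σ.m i) (by decide)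
    ⟨fun a b hb h => by
      rw [State.set_m, hq2]; exact hI a (by omega) b hb, by simpa [hq2] using hm⟩ ?_
  · rw [e1, h1] at key
    exact ⟨fun a ha b hb => key.1 a b hb (by omega), key.2⟩
  intro j hj τ' hx' hfr' ⟨hI', hm'⟩
  rw [e1, h1] at hj
  have g0 := (hfr' 0 (by decide)).trans e0
  have g1 := (hfr' 1 (by decide)).trans e1
  have g2 := (hfr' 2 (by decide)).trans e2
  have g4 := (hfr' 4 (by decide)).trans e4
  have g9 := (hfr' 9 (by decide)).trans e9
  have g10 := (hfr' 10 (by decide)).trans e10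
  have g22 := hfr' 22 (by decide)
  obtain ⟨hc1, hc2⟩ := capacity_spec A (n := n) τ' (by rw [g0, h0])
    (by rw [g22, hq1, hx, g10]) (by omega) (by omega) (by
      intro u hu w hw
      rw [hm' _ (Or.inl (index_lt hw hu)), hA u hu w hw])
  have hc3 := fun z (hz : z ∉ capacity.writes) => Cmd.eval_v_of_notMem _ τ' hz
  simp only [Cmd.eval_block_cons, Cmd.eval_block_nil]
  generalize capacity.eval τ' = ρ' at *
  have k1 := (hc3 1 (by decide)).trans (g1.trans h1)
  have k2 := (hc3 2 (by decide)).trans (g2.trans h2)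
  have k10 := (hc3 10 (by decide)).trans g10
  have k11 := (hc3 11 (by decide)).trans hx'
  rw [g4, g9, g10, hx'] at hc1
  simp only [writeEntry, Cmd.eval_block_cons, Cmd.eval_block_nil]
  simp [k1, k2, k10, k11, hc1, hc2, entry]
  constructor
  · intro a b hb hab
    simp only [index_inj hb hj]
    split_ifs with h
    · rw [h.1, h.2]
    · exact hI' a b hb (by omega)
  · intro x hx
    rw [if_neg, hm' x hx]
    have h3 := index_lt (s := 3 + n * n) hj hi
    have h4 := le_index (s := 3 + n * n) (N := 4 * n) (b := j) (Nat.zero_le i)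
    omega

/-! ### Search in the residual network. -/

/-- A rooted tree in the residual network, given by depths (the root has depth `1`, the nodes
outside the tree have depth `0`) and predecessors. -/
structure IsSearchTree (N s : ℕ) (R : ℕ → ℕ → ℕ) (d p : ℕ → ℕ) : Prop where
  source : d s = 1
  pred : ∀ b < N, b ≠ s → 0 < d b → p b < N ∧ 0 < d (p b) ∧ d b = d (p b) + 1 ∧ 0 < R (p b) b
  le_card : ∀ b < N, d b ≤ ((range N).filter fun c => 0 < d c).card

/-- A new node is at most one deeper than the old tree is large, and it enlarges the tree by one.
Depths thus stay at most `N`, which lets `N` steps back reach the root. -/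
theorem IsSearchTree.extend {N s : ℕ} {R : ℕ → ℕ → ℕ} {d p d' p' : ℕ → ℕ}
    (h : IsSearchTree N s R d p) (hs : s < N) {a b : ℕ} (ha : a < N) (hb : b < N) (hda : 0 < d a)
    (hdb : d b = 0) (hR : 0 < R a b) (hd : ∀ c < N, d' c = if c = b then d a + 1 else d c)
    (hp : ∀ c < N, p' c = if c = b then a else p c) : IsSearchTree N s R d' p' := by
  have hsb : s ≠ b := by rintro rfl; have := h.source; omega
  have hab : a ≠ b := by rintro rfl; omega
  have hcard : ((range N).filter fun c => 0 < d c).card + 1 ≤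
      ((range N).filter fun c => 0 < d' c).card := by
    rw [← card_insert_of_notMem (a := b) (by simp [hdb])]
    refine card_le_card fun c hc => ?_
    rw [mem_insert, mem_filter, mem_range] at hc
    rw [mem_filter, mem_range]
    rcases hc with rfl | hc
    · exact ⟨hb, by rw [hd _ hb]; simp⟩
    · refine ⟨hc.1, ?_⟩
      rw [hd _ hc.1]; split_ifs <;> omega
  refine ⟨by rw [hd s hs, if_neg hsb, h.source], fun c hc hcs hdc => ?_, fun c hc => ?_⟩
  · rw [hp c hc]
    rw [hd c hc] at hdc ⊢
    split_ifs at hdc ⊢ with hcb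
    · rw [hd a ha, if_neg hab]
      exact ⟨ha, hda, rfl, hcb ▸ hR⟩
    · obtain ⟨h1, h2, h3, h4⟩ := h.pred c hc hcs hdc
      have : p c ≠ b := fun hpb => by rw [hpb] at h2; omega
      rw [hd _ h1, if_neg this]
      exact ⟨h1, h2, h3, h4⟩
  · rw [hd c hc]
    have h1 := h.le_card c hc
    have h2 := h.le_card a ha
    split_ifs <;> omega

theorem relax_spec (τ : State) {B N a b : ℕ} (h1 : τ.v 1 = N) (h2 : τ.v 2 = B)
    (h10 : τ.v 10 = a) (h11 : τ.v 11 = b) :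
    (0 < entry τ.m B N N a ∧ entry τ.m B N N b = 0 ∧ 0 < entry τ.m B N a b ∧
      ∀ i, (relax.eval τ).m i = if i = B + N * (N + 1) + b then a else
        if i = B + N * N + b then entry τ.m B N N a + 1 else τ.m i) ∨
    (¬ (0 < entry τ.m B N N a ∧ entry τ.m B N N b = 0 ∧ 0 < entry τ.m B N a b) ∧
      (relax.eval τ).m = τ.m) := by
  simp [relax, readEntry, writeEntry, depthRow, predRow, h1, h2, h10, h11, entry]
  split_ifs with h3 h4 h5
  · right; exact ⟨by omega, by simp⟩
  · left; exact ⟨h3, by omega, h5, by simp⟩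
  · right; exact ⟨by omega, by simp⟩
  · right; exact ⟨by omega, by simp⟩

/-- The situation when the arcs before `(i, j)` have been scanned. -/
structure ScanInvariant (B N s : ℕ) (m₀ m : ℕ → ℕ) (i j : ℕ) : Prop where
  frame : ∀ x, (x < B + N * N ∨ B + N * (N + 2) ≤ x) → m x = m₀ x
  tree : IsSearchTree N s (entry m₀ B N) (entry m B N N) (entry m B N (N + 1))
  mono : ∀ c < N, 0 < entry m₀ B N N c → 0 < entry m B N N c
  scanned : ∀ a < N, ∀ b < N, (a < i ∨ a = i ∧ b < j) → 0 < entry m₀ B N N a →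
    0 < entry m₀ B N a b → 0 < entry m B N N b
  -- A tree that was already closed under residual arcs does not grow in the scan.
  closed : (∀ a < N, ∀ b < N, 0 < entry m₀ B N N a → 0 < entry m₀ B N a b → 0 < entry m₀ B N N b) →
    ∀ c < N, 0 < entry m B N N c → 0 < entry m₀ B N N c

theorem ScanInvariant.relax {B N s i j : ℕ} {m₀ : ℕ → ℕ} {τ : State} (hs : s < N)
    (h : ScanInvariant B N s m₀ τ.m i j) (h1 : τ.v 1 = N) (h2 : τ.v 2 = B)
    (h10 : τ.v 10 = i) (h11 : τ.v 11 = j) (hi : i < N) (hj : j < N) :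
    ScanInvariant B N s m₀ (relax.eval τ).m i (j + 1) := by
  have hR : ∀ a < N, ∀ b < N, entry τ.m B N a b = entry m₀ B N a b := fun a ha b hb =>
    h.frame _ (Or.inl (index_lt hb ha))
  rcases relax_spec τ h1 h2 h10 h11 with ⟨h3, h4, h5, h6⟩ | ⟨h3, h4⟩
  · have hd : ∀ c < N, entry (LoopLang.relax.eval τ).m B N N c =
        if c = j then entry τ.m B N N i + 1 else entry τ.m B N N c := by
      intro c hc
      rw [entry, h6]
      simp only [index_inj hc hj]
      simp [entry]
    have hp : ∀ c < N, entry (LoopLang.relax.eval τ).m B N (N + 1) c =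
        if c = j then i else entry τ.m B N (N + 1) c := by
      intro c hc
      rw [entry, h6]
      simp only [index_inj hc hj]
      simp [entry]
    rw [hR i hi j hj] at h5
    have hpos : ∀ c < N, 0 < entry τ.m B N N c → 0 < entry (LoopLang.relax.eval τ).m B N N c := by
      intro c hc hpos
      rw [hd c hc]; split_ifs <;> omega
    refine ⟨fun x hx => ?_, h.tree.extend hs hi hj h3 h4 h5 hd hp,
      fun c hc hc' => hpos c hc (h.mono c hc hc'), fun a ha b hb hab hda hRab => ?_,
      fun hcl c hc hdc => ?_⟩
    · rw [h6, if_neg, if_neg, h.frame x hx]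
      · have := index_lt (s := B) hj (show N < N + 2 by omega)
        omega
      · have := index_lt (s := B) hj (show N + 1 < N + 2 by omega)
        have := le_index (s := B) (N := N) (b := j) (show N ≤ N + 1 by omega)
        omega
    · by_cases hbj : b = j
      · rw [hd b hb, if_pos hbj]; omega
      · exact hpos b hb (h.scanned a ha b hb (by omega) hda hRab)
    · rw [hd c hc] at hdc
      split_ifs at hdc with hcj
      · subst hcj
        exact hcl i hi c hc (h.closed hcl i hi h3) h5
      · exact h.closed hcl c hc hdc
  · rw [h4]
    refine ⟨h.frame, h.tree, h.mono, fun a ha b hb hab hda hRab => ?_, h.closed⟩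
    by_cases hab' : a = i ∧ b = j
    · obtain ⟨rfl, rfl⟩ := hab'
      have := h.mono a ha hda
      rw [hR a ha b hb] at h3
      omega
    · exact h.scanned a ha b hb (by omega) hda hRab

theorem relaxAll_spec (σ : State) {B N s : ℕ} (hs : s < N) (h1 : σ.v 1 = N) (h2 : σ.v 2 = B)
    (hT : IsSearchTree N s (entry σ.m B N) (entry σ.m B N N) (entry σ.m B N (N + 1))) :
    ScanInvariant B N s σ.m (relaxAll.eval σ).m N 0 := by
  have key := Cmd.eval_loop_induction (x := 10) (y := 1) (σ := σ) (c := .loop 11 1 relax)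
    (fun i τ => ScanInvariant B N s σ.m τ.m i 0) (by decide)
    ⟨fun _ _ => rfl, hT, fun _ _ h => h, fun _ _ _ _ h => by omega, fun _ _ _ h => h⟩ ?_
  · rw [h1] at key
    exact key
  intro i hi τ hx hfr hI
  rw [h1] at hi
  have e1 := (hfr 1 (by decide)).trans h1
  have e2 := (hfr 2 (by decide)).trans h2
  have key := Cmd.eval_loop_induction (x := 11) (y := 1) (σ := τ) (c := relax)
    (fun j τ => ScanInvariant B N s σ.m τ.m i j) (by decide) hI ?_
  · rw [e1] at key
    exact ⟨key.frame, key.tree, key.mono, fun a ha b hb hab => key.scanned a ha b hb (by omega),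
      key.closed⟩
  intro j hj τ' hx' hfr' hI'
  exact hI'.relax hs ((hfr' 1 (by decide)).trans e1) ((hfr' 2 (by decide)).trans e2)
    ((hfr' 10 (by decide)).trans hx) hx' hi (by omega)

end LoopLang

namespace LoopLang

open Finset DOCT

theorem IsSearchTree.congr {N s : ℕ} {R R' : ℕ → ℕ → ℕ} {d p : ℕ → ℕ}
    (h : IsSearchTree N s R d p) (hR : ∀ a < N, ∀ b < N, R a b = R' a b) :
    IsSearchTree N s R' d p :=
  ⟨h.source, fun b hb hbs hdb => by
    obtain ⟨h1, h2, h3, h4⟩ := h.pred b hb hbs hdb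
    exact ⟨h1, h2, h3, hR _ h1 b hb ▸ h4⟩, h.le_card⟩

/-- The situation after a search from `s` in the network with the residual capacities `R`: the tree
is closed under arcs with positive capacity. -/
structure IsSearchResult (N s : ℕ) (R : ℕ → ℕ → ℕ) (d p : ℕ → ℕ) : Prop
    extends IsSearchTree N s R d p where
  closed : ∀ a < N, ∀ b < N, 0 < d a → 0 < R a b → 0 < d b

/-- A scan either adds a node or certifies that the tree is closed. If it were still not closed
after `N` scans, it would have more than `N` nodes. -/
theorem search_spec (σ : State) {B N s : ℕ} (hs : s < N) (h1 : σ.v 1 = N) (h2 : σ.v 2 = B)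
    (h17 : σ.v 17 = s) :
    (∀ x, (x < B + N * N ∨ B + N * (N + 2) ≤ x) → (search.eval σ).m x = σ.m x) ∧
    IsSearchResult N s (entry σ.m B N) (entry (search.eval σ).m B N N)
      (entry (search.eval σ).m B N (N + 1)) := by
  have init := Cmd.eval_loop_induction (x := 11) (y := 1) (σ := σ)
    (c := writeEntry depthRow (.var 11) (.lit 0))
    (fun j τ => (∀ b < j, entry τ.m B N N b = 0) ∧
      ∀ x, (x < B + N * N ∨ B + N * (N + 2) ≤ x) → τ.m x = σ.m x) (by decide) (by simp) (by
      rintro j hj τ hx hfr ⟨hI, hm⟩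
      rw [h1] at hj
      have e1 := (hfr 1 (by decide)).trans h1
      have e2 := (hfr 2 (by decide)).trans h2
      simp [writeEntry, depthRow, e1, e2, hx, entry]
      refine ⟨fun b hb _ => hI b (by omega), fun x hx' => ?_⟩
      rw [if_neg, hm x hx']
      have := index_lt (s := B) hj (show N < N + 2 by omega)
      omega)
  have fr := fun z hz =>
    Cmd.eval_v_of_notMem (z := z) (.loop 11 1 (writeEntry depthRow (.var 11) (.lit 0))) σ hz
  simp only [search, Cmd.eval_block_cons, Cmd.eval_block_nil]
  generalize (Cmd.loop 11 1 (writeEntry depthRow (.var 11) (.lit 0))).eval σ = ρ at *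
  rw [h1] at init
  have e1 := (fr 1 (by decide)).trans h1
  have e2 := (fr 2 (by decide)).trans h2
  have e17 := (fr 17 (by decide)).trans h17
  have hm : ∀ x, ((writeEntry depthRow (.var 17) (.lit 1)).eval ρ).m x =
      if x = B + N * N + s then 1 else ρ.m x := by
    intro x
    simp [writeEntry, depthRow, e1, e2, e17]
  have fr' := fun z hz =>
    Cmd.eval_v_of_notMem (z := z) (writeEntry depthRow (.var 17) (.lit 1)) ρ hz
  generalize (writeEntry depthRow (.var 17) (.lit 1)).eval ρ = ρ' at *
  have e1' := (fr' 1 (by decide)).trans e1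
  have e2' := (fr' 2 (by decide)).trans e2
  have hd : ∀ b < N, entry ρ'.m B N N b = if b = s then 1 else 0 := by
    intro b hb
    rw [entry, hm]
    simp only [index_inj hb hs]
    have := init.1 b hb
    simp only [entry] at this
    simp [this]
  have hfr : ∀ x, (x < B + N * N ∨ B + N * (N + 2) ≤ x) → ρ'.m x = σ.m x := by
    intro x hx
    rw [hm, if_neg, init.2 x hx]
    have := index_lt (s := B) hs (show N < N + 2 by omega)
    omega
  have tree : IsSearchTree N s (entry σ.m B N) (entry ρ'.m B N N) (entry ρ'.m B N (N + 1)) := by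
    refine ⟨by rw [hd s hs, if_pos rfl], fun b hb hbs hdb => ?_, fun b hb => ?_⟩
    · rw [hd b hb, if_neg hbs] at hdb; omega
    · have : 0 < ((range N).filter fun c => 0 < entry ρ'.m B N N c).card :=
        card_pos.2 ⟨s, by rw [mem_filter, hd s hs]; simp [hs]⟩
      rw [hd b hb]; split_ifs <;> omega
  have key := Cmd.eval_loop_induction (x := 12) (y := 1) (σ := ρ') (c := relaxAll)
    (fun i τ => (∀ x, (x < B + N * N ∨ B + N * (N + 2) ≤ x) → τ.m x = σ.m x) ∧
      IsSearchTree N s (entry σ.m B N) (entry τ.m B N N) (entry τ.m B N (N + 1)) ∧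
      ((∀ a < N, ∀ b < N, 0 < entry τ.m B N N a → 0 < entry σ.m B N a b → 0 < entry τ.m B N N b) ∨
        i + 1 ≤ ((range N).filter fun c => 0 < entry τ.m B N N c).card)) (by decide)
    ⟨hfr, tree, Or.inr ?_⟩ ?_
  · rw [e1'] at key
    obtain ⟨k1, k2, k3⟩ := key
    refine ⟨k1, k2, ?_⟩
    rcases k3 with k3 | k3
    · exact k3
    · have := card_filter_le (range N) fun c => 0 < entry
        (((Cmd.loop 12 1 relaxAll).eval ρ').m) B N N c
      rw [card_range] at this
      omega
  · rw [zero_add, Nat.one_le_iff_ne_zero, ← Nat.pos_iff_ne_zero, card_pos]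
    exact ⟨s, by rw [mem_filter, State.set_m, hd s hs]; simp [hs]⟩
  · rintro i - τ hx hfr'' ⟨hI, hT, hC⟩
    have hR : ∀ a < N, ∀ b < N, entry σ.m B N a b = entry τ.m B N a b := fun a ha b hb =>
      (hI _ (Or.inl (index_lt hb ha))).symm
    have sc := relaxAll_spec τ hs ((hfr'' 1 (by decide)).trans e1')
      ((hfr'' 2 (by decide)).trans e2') (hT.congr hR)
    simp only [State.set_m]
    refine ⟨fun x hx => by rw [sc.frame x hx, hI x hx],
      sc.tree.congr fun a ha b hb => (hR a ha b hb).symm, ?_⟩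
    have hsub : ((range N).filter fun c => 0 < entry τ.m B N N c) ⊆
        (range N).filter fun c => 0 < entry (relaxAll.eval τ).m B N N c := by
      intro c hc
      rw [mem_filter, mem_range] at hc ⊢
      exact ⟨hc.1, sc.mono c hc.1 hc.2⟩
    by_cases heq : ∀ c < N, 0 < entry (relaxAll.eval τ).m B N N c → 0 < entry τ.m B N N c
    · left
      intro a ha b hb hda hRab
      rw [hR a ha b hb] at hRab
      exact sc.scanned a ha b hb (Or.inl ha) (heq a ha hda) hRab
    · right
      push Not at heq
      obtain ⟨c, hc, hdc, hdc'⟩ := heq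
      have hlt := card_lt_card (Finset.ssubset_iff_subset_ne.2 ⟨hsub, fun h => by
        have hc' : c ∈ (range N).filter fun c => 0 < entry (relaxAll.eval τ).m B N N c := by
          rw [mem_filter, mem_range]; exact ⟨hc, hdc⟩
        rw [← h, mem_filter] at hc'
        omega⟩)
      rcases hC with hC | hC
      · have := sc.closed (fun a ha b hb h h' => hC a ha b hb h (by rwa [hR a ha b hb])) c hc hdc
        omega
      · change i + 1 + 1 ≤ ((range N).filter fun c => 0 < entry (relaxAll.eval τ).m B N N c).card
        omega

/-! ### Augmenting paths and the cut value. -/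

theorem stepBack_spec (τ : State) {B N c : ℕ} (h1 : τ.v 1 = N) (h2 : τ.v 2 = B)
    (h15 : τ.v 15 = c) (hc : c < N) :
    (entry τ.m B N N c ≤ 1 → (stepBack.eval τ).v 15 = c ∧ (stepBack.eval τ).m = τ.m) ∧
    ∀ p, 1 < entry τ.m B N N c → p = entry τ.m B N (N + 1) c → p < N → p ≠ c →
      (stepBack.eval τ).v 15 = p ∧
      (∀ x, (x < B ∨ B + N * N ≤ x) → (stepBack.eval τ).m x = τ.m x) ∧
      ∀ a < N, ∀ b < N, entry (stepBack.eval τ).m B N a b = push (entry τ.m B N) p c a b := by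
  constructor
  · intro h
    simp only [entry] at h
    simp [stepBack, readEntry, depthRow, h1, h2, h15]
    rw [if_neg (by omega)]
    simp [h15]
  · intro p h hp hpN hpc
    simp only [entry] at h hp
    -- The arc and its reverse occupy different cells, so the first write does not disturb the
    -- second read.
    have hne : B + N * c + p ≠ B + N * p + c := fun h' => hpc ((index_inj hpN hc).1 h').2
    simp [stepBack, readEntry, writeEntry, depthRow, predRow, h1, h2, h15, h, ← hp, entry, hne]
    have i1 := index_lt (s := B) hc hpN
    have i2 := index_lt (s := B) hpN hc
    constructor
    · intro x hx
      rw [if_neg, if_neg]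
      · have := le_index (s := B) (N := N) (b := c) (Nat.zero_le p)
        omega
      · have := le_index (s := B) (N := N) (b := p) (Nat.zero_le c)
        omega
    · intro a ha b hb
      simp only [index_inj hb hpN, index_inj hb hc, push]
      by_cases h3 : a = p ∧ b = c
      · obtain ⟨rfl, rfl⟩ := h3
        rw [if_neg (fun h => hpc h.1)]
        simp [entry]
      · by_cases h4 : a = c ∧ b = p
        · obtain ⟨rfl, rfl⟩ := h4
          simp [h3, entry]
        · simp [h3, h4, entry]

/-- The situation while one unit is sent along the path from `c` to `t`. -/
structure AugmentInvariant (B N s t : ℕ) (m₀ m : ℕ → ℕ) (c i : ℕ) : Prop where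
  lt : c < N
  depth_pos : 0 < entry m₀ B N N c
  -- At `i = N` the second alternative contradicts positive depth, so `c` is the root.
  depth_le : entry m₀ B N N c ≤ 1 ∨ entry m₀ B N N c + i ≤ N
  frame : ∀ x, (x < B ∨ B + N * N ≤ x) → m x = m₀ x
  -- The unit has been sent from `c` to `t` so far: nothing is lost at `c = t`, and one unit of each
  -- separating cut at `c = s`.
  cut_eq : ∀ U : Finset ℕ, t ∉ U →
    cut N (entry m B N) U + (if c ∈ U then 1 else 0) = cut N (entry m₀ B N) U
  -- The tree arcs still to be used keep their capacity.
  pos : ∀ b < N, b ≠ s → 0 < entry m₀ B N N b → entry m₀ B N N b ≤ entry m₀ B N N c →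
    0 < entry m B N (entry m₀ B N (N + 1) b) b

theorem IsSearchTree.eq_source {N s : ℕ} {R : ℕ → ℕ → ℕ} {d p : ℕ → ℕ}
    (h : IsSearchTree N s R d p) {b : ℕ} (hb : b < N) (h0 : 0 < d b) (h1 : d b ≤ 1) : b = s := by
  by_contra hbs
  obtain ⟨-, h2, h3, -⟩ := h.pred b hb hbs h0
  omega

theorem augment_spec (σ : State) {B N s t : ℕ} (ht : t < N) (h1 : σ.v 1 = N)
    (h2 : σ.v 2 = B) (h18 : σ.v 18 = t)
    (hT : IsSearchTree N s (entry σ.m B N) (entry σ.m B N N) (entry σ.m B N (N + 1)))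
    (hdt : 0 < entry σ.m B N N t) :
    (∀ x, (x < B ∨ B + N * N ≤ x) → (augment.eval σ).m x = σ.m x) ∧
    ∀ U : Finset ℕ, s ∈ U → t ∉ U →
      cut N (entry (augment.eval σ).m B N) U + 1 = cut N (entry σ.m B N) U := by
  have key := Cmd.eval_loop_induction (x := 24) (y := 1) (σ := σ.set 15 t) (c := stepBack)
    (fun i τ => AugmentInvariant B N s t σ.m τ.m (τ.v 15) i) (by decide) ?_ ?_
  · simp only [augment, Cmd.eval_block_cons, Cmd.eval_block_nil, Cmd.eval_assign, Expr.eval, h18]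
    rw [show (σ.set 15 t).v 1 = N by simp [h1]] at key
    generalize (Cmd.loop 24 1 stepBack).eval (σ.set 15 t) = ρ at *
    have hcs : ρ.v 15 = s := hT.eq_source key.lt key.depth_pos (by
      have := key.depth_le; have := key.depth_pos; omega)
    refine ⟨key.frame, fun U hs hU => ?_⟩
    have := key.cut_eq U hU
    rwa [hcs, if_pos hs] at this
  · refine ⟨by simpa using ht, by simpa using hdt, Or.inr ?_, fun _ _ => rfl, fun U hU => ?_,
      fun b hb hbs hdb _ => (hT.pred b hb hbs hdb).2.2.2⟩
    · have h3 := hT.le_card t ht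
      have h4 := card_filter_le (range N) fun c => 0 < entry σ.m B N N c
      rw [card_range] at h4
      simp only [State.set_v]
      simp; omega
    · simp [hU]
  · intro i hi τ hx hfr hI
    have e1 : τ.v 1 = N := (hfr 1 (by decide)).trans (by simp [h1])
    have e2 : τ.v 2 = B := (hfr 2 (by decide)).trans (by simp [h2])
    have hrow : ∀ r b, N ≤ r → entry τ.m B N r b = entry σ.m B N r b := fun r b hr =>
      hI.frame _ (Or.inr (le_index hr))
    generalize hcur : τ.v 15 = c at *
    obtain ⟨s1, s2⟩ := stepBack_spec τ e1 e2 hcur hI.lt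
    rw [hrow N c le_rfl] at s1 s2
    rcases Nat.lt_or_ge 1 (entry σ.m B N N c) with hd | hd
    · have hcs : c ≠ s := by rintro rfl; have := hT.source; omega
      obtain ⟨p1, p2, p3, p4⟩ := hT.pred c hI.lt hcs hI.depth_pos
      have hpc : entry σ.m B N (N + 1) c ≠ c := fun h => by rw [h] at p3; omega
      obtain ⟨q1, q2, q3⟩ := s2 _ hd (hrow (N + 1) c (by omega)).symm p1 hpc
      simp only [State.set_v, State.set_m]
      simp only [Nat.reduceEqDiff, if_false, q1]
      refine ⟨p1, p2, ?_, fun x hx => by rw [q2 x hx, hI.frame x hx], fun U hU => ?_,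
        fun b hb hbs hdb hle => ?_⟩
      · have := hI.depth_le; omega
      · rw [cut_congr q3 U, cut_push p1 hI.lt hpc (hI.pos c hI.lt hcs hI.depth_pos le_rfl),
          hI.cut_eq U hU]
      · obtain ⟨r1, -, -, -⟩ := hT.pred b hb hbs hdb
        have hbc : b ≠ c := by rintro rfl; omega
        have := hI.pos b hb hbs hdb (by omega)
        -- Only the arc into `c` loses capacity, and `b` has smaller depth than `c`.
        rw [q3 _ r1 b hb, push, if_neg (fun h => hbc h.2)]
        split_ifs <;> omega
    · obtain ⟨q1, q2⟩ := s1 hd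
      simp only [State.set_v, State.set_m, q2]
      simp only [Nat.reduceEqDiff, if_false, q1]
      exact ⟨hI.lt, hI.depth_pos, Or.inl hd, hI.frame, hI.cut_eq, hI.pos⟩

/-- The situation after `r` rounds, when `f` units have been sent. -/
structure FlowInvariant (B N s t : ℕ) (R : ℕ → ℕ → ℕ) (m₀ m : ℕ → ℕ) (f r : ℕ) : Prop where
  frame : ∀ x, (x < B ∨ B + N * (N + 2) ≤ x) → m x = m₀ x
  cut_eq : ∀ U : Finset ℕ, s ∈ U → t ∉ U → cut N (entry m B N) U + f = cut N R U
  done : f = r ∨ ∃ U : Finset ℕ, s ∈ U ∧ t ∉ U ∧ cut N R U = f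

/-- Max-flow min-cut in terms of cuts: each augmentation lowers all separating cuts by one. When the
search misses the sink, no residual capacity leaves the reached set, so its original capacity equals
the number of units sent. -/
theorem improve_spec (σ : State) {B N s t f r : ℕ} {R : ℕ → ℕ → ℕ} {m₀ : ℕ → ℕ} (hs : s < N)
    (ht : t < N) (h1 : σ.v 1 = N) (h2 : σ.v 2 = B) (h17 : σ.v 17 = s) (h18 : σ.v 18 = t)
    (h14 : σ.v 14 = f) (hI : FlowInvariant B N s t R m₀ σ.m f r) :
    FlowInvariant B N s t R m₀ (improve.eval σ).m ((improve.eval σ).v 14) (r + 1) := by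
  obtain ⟨s1, s2⟩ := search_spec σ hs h1 h2 h17
  have fr := fun z hz => Cmd.eval_v_of_notMem (z := z) search σ hz
  simp only [improve, Cmd.eval_block_cons, Cmd.eval_block_nil]
  generalize search.eval σ = ρ at *
  have e1 := (fr 1 (by decide)).trans h1
  have e2 := (fr 2 (by decide)).trans h2
  have e14 := (fr 14 (by decide)).trans h14
  have e18 := (fr 18 (by decide)).trans h18
  have r1 : ((readEntry 19 depthRow (.var 18)).eval ρ).m = ρ.m := by simp [readEntry]
  have r2 : ((readEntry 19 depthRow (.var 18)).eval ρ).v 19 = entry ρ.m B N N t := by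
    simp [readEntry, depthRow, entry, e1, e2, e18]
  have fr' := fun z hz => Cmd.eval_v_of_notMem (z := z) (readEntry 19 depthRow (.var 18)) ρ hz
  generalize (readEntry 19 depthRow (.var 18)).eval ρ = ρ' at *
  have g1 := (fr' 1 (by decide)).trans e1
  have g2 := (fr' 2 (by decide)).trans e2
  have g14 := (fr' 14 (by decide)).trans e14
  have g18 := (fr' 18 (by decide)).trans e18
  have hR : ∀ a < N, ∀ b < N, entry σ.m B N a b = entry ρ'.m B N a b := fun a ha b hb => by
    rw [entry, entry, r1, s1 _ (Or.inl (index_lt hb ha))]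
  have hN : B + N * N ≤ B + N * (N + 2) := le_index (b := 0) (by omega)
  simp only [Cmd.eval_ite, Expr.eval, r2, Cmd.eval_block_cons, Cmd.eval_block_nil,
    Cmd.eval_assign, Cmd.eval_skip]
  split_ifs with hd
  · obtain ⟨a1, a2⟩ := augment_spec ρ' (s := s) ht g1 g2 g18
      (by rw [r1] at hR ⊢; exact s2.toIsSearchTree.congr hR) (by rw [r1]; exact hd)
    have a3 := Cmd.eval_v_of_notMem (z := 14) augment ρ' (by decide)
    simp only [State.set_v, State.set_m, if_true, a3, g14]
    have hcut : ∀ U : Finset ℕ, s ∈ U → t ∉ U →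
        cut N (entry (augment.eval ρ').m B N) U + (f + 1) = cut N R U := by
      intro U hsU htU
      have := a2 U hsU htU
      rw [← cut_congr hR] at this
      have := hI.cut_eq U hsU htU
      omega
    refine ⟨fun x hx => ?_, hcut, ?_⟩
    · rw [a1 x (by omega), r1, s1 x (by omega), hI.frame x hx]
    · rcases hI.done with h | ⟨U, hsU, htU, hU⟩
      · left; rw [h]
      -- A cut of original capacity `f` has residual capacity 0 and admits no further unit.
      · have := hcut U hsU htU
        omega
  · simp only [r1, g14]
    refine ⟨fun x hx => by rw [s1 x (by omega), hI.frame x hx], fun U hsU htU => ?_, Or.inr ?_⟩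
    · rw [r1] at hR
      rw [← cut_congr hR]
      exact hI.cut_eq U hsU htU
    · refine ⟨(range N).filter fun c => 0 < entry ρ.m B N N c, ?_, ?_, ?_⟩
      · rw [mem_filter, mem_range, s2.source]; exact ⟨hs, one_pos⟩
      · rw [mem_filter]; exact fun h => hd h.2
      · rw [← hI.cut_eq _ (by rw [mem_filter, mem_range, s2.source]; exact ⟨hs, one_pos⟩)
          (by rw [mem_filter]; exact fun h => hd h.2), Nat.add_eq_right, cut]
        refine sum_eq_zero fun a ha => sum_eq_zero fun b hb => ?_
        rw [mem_range] at ha hb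
        split_ifs with h
        · by_contra hpos
          rw [mem_filter, mem_filter, mem_range, mem_range] at h
          exact h.2 ⟨hb, s2.closed a ha b hb h.1.2 (Nat.pos_of_ne_zero hpos)⟩
        · rfl

theorem cutValue_spec {n : ℕ} (D : Digraph (Fin n)) (v : Fin n) (σ : State) (h0 : σ.v 0 = n)
    (h1 : σ.v 1 = 4 * n) (h2 : σ.v 2 = 3 + n * n) (h4 : σ.v 4 = 2 * n + 1) (h9 : σ.v 9 = v)
    (hA : ∀ u < n, ∀ w < n, 0 < σ.m (3 + n * u + w) ↔ natAdj D u w) :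
    IsCutValue D v ((cutValue.eval σ).v 14) ∧
    ∀ x, (x < 3 + n * n ∨ 3 + n * n + 4 * n * (4 * n + 2) ≤ x) →
      (cutValue.eval σ).m x = σ.m x := by
  have hv := v.2
  simp only [cutValue, Cmd.eval_block_cons, Cmd.eval_block_nil, Cmd.eval_assign, Expr.eval]
  generalize hρ : (σ.set 17 _).set 18 _ = ρ
  have e0 : ρ.v 0 = n := by rw [← hρ]; simp [h0]
  have e1 : ρ.v 1 = 4 * n := by rw [← hρ]; simp [h1]
  have e2 : ρ.v 2 = 3 + n * n := by rw [← hρ]; simp [h2]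
  have e4 : ρ.v 4 = 2 * n + 1 := by rw [← hρ]; simp [h4]
  have e9 : ρ.v 9 = v := by rw [← hρ]; simp [h9]
  have e17 : ρ.v 17 = 4 * (v : ℕ) + 1 := by rw [← hρ]; simp [h9]; omega
  have e18 : ρ.v 18 = 4 * (v : ℕ) + 2 := by rw [← hρ]; simp [h9]; omega
  have em : ρ.m = σ.m := by rw [← hρ]; simp
  clear hρ
  obtain ⟨f1, f2⟩ := fill_spec (natAdj D) ρ e0 e1 e2 (by rw [em]; exact hA)
  have fr := fun z hz => Cmd.eval_v_of_notMem (z := z) fill ρ hz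
  generalize fill.eval ρ = ρ' at *
  rw [e4, e9] at f1
  have hN : 3 + n * n + 4 * n * (4 * n) ≤ 3 + n * n + 4 * n * (4 * n + 2) :=
    le_index (b := 0) (by omega)
  have key := Cmd.eval_loop_induction (x := 13) (y := 4) (σ := ρ'.set 14 0) (c := improve)
    (fun r τ => FlowInvariant (3 + n * n) (4 * n) (4 * v + 1) (4 * v + 2)
      (cap (natAdj D) (2 * n + 1) v) σ.m τ.m (τ.v 14) r) (by decide) ?_ ?_
  · rw [show (ρ'.set 14 0).v 4 = 2 * n + 1 by simp [(fr 4 (by decide)).trans e4]] at key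
    -- The number of rounds is the cap itself, so success in every round is the first alternative of
    -- `exists_cut`.
    refine ⟨⟨fun U hsU htU => ?_, key.done⟩, key.frame⟩
    have := key.cut_eq U hsU htU
    omega
  · refine ⟨fun x hx => ?_, fun U _ _ => ?_, Or.inl (by simp)⟩
    · simp only [State.set_m]
      rw [f2 x (by omega), em]
    · simpa using cut_congr f1 U
  · intro r hr τ hx hfr hI
    have := improve_spec τ (by omega) (by omega)
      ((hfr 1 (by decide)).trans (by simp [(fr 1 (by decide)).trans e1]))
      ((hfr 2 (by decide)).trans (by simp [(fr 2 (by decide)).trans e2]))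
      ((hfr 17 (by decide)).trans (by simp [(fr 17 (by decide)).trans e17]))
      ((hfr 18 (by decide)).trans (by simp [(fr 18 (by decide)).trans e18])) rfl hI
    simpa using this

theorem decideAll_spec {n k : ℕ} (D : Digraph (Fin n)) (σ : State) (h0 : σ.v 0 = n)
    (h1 : σ.v 1 = 4 * n) (h2 : σ.v 2 = 3 + n * n) (h3 : σ.v 3 = k) (h4 : σ.v 4 = 2 * n + 1)
    (hA : ∀ u < n, ∀ w < n, 0 < σ.m (3 + n * u + w) ↔ natAdj D u w) (v : Fin n) :
    ∃ f, IsCutValue D v f ∧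
      entry (decideAll.eval σ).m (3 + n * n) (4 * n) (4 * n + 2) v = f - k := by
  have key := Cmd.eval_loop_induction (x := 9) (y := 0) (σ := σ)
    (c := .block [cutValue, writeEntry outRow (.var 9) (.sub (.var 14) (.var 3))])
    (fun i τ => (∀ v : Fin n, (v : ℕ) < i → ∃ f, IsCutValue D v f ∧
      entry τ.m (3 + n * n) (4 * n) (4 * n + 2) v = f - k) ∧ ∀ x < 3 + n * n, τ.m x = σ.m x)
    (by decide) (by simp) ?_
  · rw [h0] at key
    exact key.1 v v.2
  rintro i hi τ hx hfr ⟨hI, hm⟩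
  rw [h0] at hi
  obtain ⟨c1, c2⟩ := cutValue_spec D ⟨i, hi⟩ τ ((hfr 0 (by decide)).trans h0)
    ((hfr 1 (by decide)).trans h1) ((hfr 2 (by decide)).trans h2) ((hfr 4 (by decide)).trans h4) hx
    (by
      intro u hu w hw
      rw [hm _ (index_lt hw hu), hA u hu w hw])
  have fr := fun z hz => Cmd.eval_v_of_notMem (z := z) cutValue τ hz
  simp only [Cmd.eval_block_cons, Cmd.eval_block_nil]
  generalize cutValue.eval τ = ρ at *
  have e1 := (fr 1 (by decide)).trans ((hfr 1 (by decide)).trans h1)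
  have e2 := (fr 2 (by decide)).trans ((hfr 2 (by decide)).trans h2)
  have e3 := (fr 3 (by decide)).trans ((hfr 3 (by decide)).trans h3)
  have e9 := (fr 9 (by decide)).trans hx
  simp [writeEntry, outRow, e1, e2, e3, e9, entry]
  constructor
  · intro w hw
    split_ifs with hwi
    · obtain rfl : w = ⟨i, hi⟩ := Fin.ext hwi
      exact ⟨_, c1, rfl⟩
    · obtain ⟨f, hf1, hf2⟩ := hI w (by omega)
      refine ⟨f, hf1, ?_⟩
      rw [c2 _ (Or.inr (le_index le_rfl))]
      exact hf2
  · intro x hx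
    rw [if_neg (by omega), c2 x (Or.inl hx), hm x hx]

/-- The target cells lie below the matrix by `hB`, so copying does not overwrite entries yet to be
read. -/
theorem copyOut_spec {n B N : ℕ} (σ : State) (h0 : σ.v 0 = n) (h1 : σ.v 1 = N) (h2 : σ.v 2 = B)
    (hB : n ≤ B) (v : ℕ) (hv : v < n) : (copyOut.eval σ).m v = entry σ.m B N (N + 2) v := by
  have key := Cmd.eval_loop_induction (x := 9) (y := 0) (σ := σ)
    (c := .block [readEntry 19 outRow (.var 9), .store (.var 9) (.var 19)])
    (fun i τ => (∀ v < i, τ.m v = entry σ.m B N (N + 2) v) ∧ ∀ x, B ≤ x → τ.m x = σ.m x)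
    (by decide) (by simp) ?_
  · rw [h0] at key
    exact key.1 v hv
  rintro i hi τ hx hfr ⟨hI, hm⟩
  have e1 := (hfr 1 (by decide)).trans h1
  have e2 := (hfr 2 (by decide)).trans h2
  simp [readEntry, outRow, hx, e1, e2, entry]
  constructor
  · intro w hw
    split_ifs with hwi
    · rw [hm _ (by omega), hwi]
    · exact hI w (by omega)
  · intro x hx
    rw [if_neg (by omega), hm x hx]

end LoopLang

namespace LoopLang

/-! ### Assembly: input, output and running time. -/

open Finset DOCT

theorem mainPart_spec {n k : ℕ} (D : Digraph (Fin n)) (σ : State) (h0 : σ.v 0 = n)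
    (h1 : σ.v 1 = 4 * n) (h3 : σ.v 3 = k) (h4 : σ.v 4 = 2 * n + 1)
    (hA : ∀ u < n, ∀ w < n, 0 < σ.m (3 + n * u + w) ↔ natAdj D u w) (v : Fin n) :
    ∃ f, IsCutValue D v f ∧ (mainPart.eval σ).m v = f - k := by
  simp only [mainPart, Cmd.eval_block_cons, Cmd.eval_block_nil, Cmd.eval_assign, Expr.eval]
  generalize hρ : ((address (.lit 3) 0 (.var 0) (.lit 0)).eval σ).set 2 _ = ρ
  have e0 : ρ.v 0 = n := by rw [← hρ]; simp [h0]
  have e1 : ρ.v 1 = 4 * n := by rw [← hρ]; simp [h1]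
  have e2 : ρ.v 2 = 3 + n * n := by rw [← hρ]; simp [h0]
  have e3 : ρ.v 3 = k := by rw [← hρ]; simp [h3]
  have e4 : ρ.v 4 = 2 * n + 1 := by rw [← hρ]; simp [h4]
  have em : ρ.m = σ.m := by rw [← hρ]; simp
  clear hρ
  obtain ⟨f, hf1, hf2⟩ := decideAll_spec D ρ e0 e1 e2 e3 e4 (by rw [em]; exact hA) v
  have fr := fun z hz => Cmd.eval_v_of_notMem (z := z) decideAll ρ hz
  refine ⟨f, hf1, ?_⟩
  rw [copyOut_spec _ ((fr 0 (by decide)).trans e0) ((fr 1 (by decide)).trans e1)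
    ((fr 2 (by decide)).trans e2) (by nlinarith) v v.2, hf2]

theorem getD_encode (I : DOCTInstance) {u w : ℕ} (hu : u < I.n) (hw : w < I.n) :
    0 < I.encode.getD (3 + I.n * u + w) 0 ↔ natAdj I.D u w := by
  have hlt : I.n * u + w < I.n * I.n := by
    simpa using index_lt (s := 0) hw hu
  rw [DOCTInstance.encode, show 3 + I.n * u + w = (I.n * u + w) + 1 + 1 + 1 by ring]
  simp only [List.getD_cons_succ]
  rw [List.getD_eq_getElem _ _ (by simpa using hlt), List.getElem_ofFn]
  have hn : 0 < I.n := by omega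
  have h1 : (I.n * u + w) / I.n = u := by
    rw [Nat.mul_add_div hn, Nat.div_eq_of_lt hw, add_zero]
  have h2 : (I.n * u + w) % I.n = w := by
    rw [Nat.mul_add_mod, Nat.mod_eq_of_lt hw]
  have h3 : (⟨I.n * u + w, hlt⟩ : Fin (I.n * I.n)).divNat = ⟨u, hu⟩ := Fin.ext h1
  have h4 : (⟨I.n * u + w, hlt⟩ : Fin (I.n * I.n)).modNat = ⟨w, hw⟩ := Fin.ext h2
  rw [h3, h4]
  simp only [natAdj]
  split_ifs with h
  · simp [hu, hw, h]
  · simp [hu, hw, h]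

/-- The adjacency matrix supplies `n * n` words and each counts at least one. No loop bound depends
on `k`. -/
theorem n_le_inputSize (I : DOCTInstance) : I.n + 1 ≤ RAM.inputSize I.encode := by
  have : I.encode.length ≤ RAM.inputSize I.encode := by
    rw [RAM.inputSize, ← List.length_map (as := I.encode) (f := fun x => Nat.size x + 1)]
    exact List.length_le_sum_of_one_le _ (by simp)
  have h2 : I.encode.length = I.n * I.n + 3 := by simp [DOCTInstance.encode]
  nlinarith

/-- The state of a loop program at the start. -/
def initialState (w : List ℕ) : State := ⟨fun _ => 0, fun a => w.getD a 0⟩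

theorem detect_spec (I : DOCTInstance) :
    IsEssentialDetectionOutput (3 : ℝ) I.D.IsOddCycleTransversal I.k
      (outputSet I.n (detect.eval (initialState I.encode)).m) := by
  have h := mainPart_spec (k := 2 * I.k.toNat) I.D (setSizes.eval (initialState I.encode))
    (by simp [setSizes, initialState, DOCTInstance.encode])
    (by simp [setSizes, initialState, DOCTInstance.encode]; ring)
    (by simp [setSizes, initialState, DOCTInstance.encode]; ring)
    (by simp [setSizes, initialState, DOCTInstance.encode]; ring)
    (by
      intro u hu w hw
      rw [← getD_encode I hu hw]
      simp [setSizes, initialState])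
  choose f hf1 hf2 using h
  refine isEssentialDetectionOutput_of_isCutValue I.D hf1 I.k fun v => ?_
  rw [outputSet, mem_filter, detect, Cmd.eval, hf2]
  simp only [mem_univ, true_and]
  omega

/-- The factor 4 covers the loop bounds n, 4n and 2n + 1 that are in force after `setSizes`. -/
theorem detect_runsWithin (I : DOCTInstance) :
    detect.RunsWithin (initialState I.encode)
      ((setSizes.time + mainPart.time).eval (4 * RAM.inputSize I.encode)) := by
  rw [Polynomial.eval_add]
  refine (Cmd.runsWithin_time _ _ (by decide) (by simp [setSizes, Cmd.block, Cmd.bounds])).seq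
    (Cmd.runsWithin_time _ _ (by decide) fun y hy => ?_)
  obtain ⟨h1, h2⟩ := bounds_mainPart y hy
  refine ⟨h1, ?_⟩
  have hn := n_le_inputSize I
  rcases h2 with rfl | rfl | rfl <;> simp [setSizes, initialState, DOCTInstance.encode] at * <;>
    omega

end LoopLang

theorem mainTheorem6 :
    RAM.SolvableInPolyTime DOCTInstance.encode
      (fun (I : DOCTInstance) (mem : ℕ → ℕ) =>
        IsEssentialDetectionOutput (3 : ℝ) I.D.IsOddCycleTransversal I.k
          (outputSet I.n mem)) := by
  refine ⟨LoopLang.detect.compile 0,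
    (LoopLang.setSizes.time + LoopLang.mainPart.time).comp (4 * Polynomial.X), fun I => ?_⟩
  obtain ⟨t, ht, h⟩ := LoopLang.detect_runsWithin I (LoopLang.detect.compile 0) 0
    (fun i x hx => by rwa [zero_add]) (RAM.initial I.encode) ⟨rfl, fun _ => rfl, rfl⟩
  refine ⟨t, by simpa [Polynomial.eval_comp] using ht, ?_, ?_⟩
  · rw [RAM.Halted, h.pc, LoopLang.Cmd.length_compile, zero_add]
  · rw [h.mem]
    exact LoopLang.detect_spec I
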